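/- **Setting.** Let $\mathcal H$ be a complex Hilbert space and $q\in[-1,1]$. Put $\lambda_1=1_{\mathcal H}$, $\lambda_2(f\otimes g)=f\otimes g+q\,g\otimes f$ on $\mathcal H^{\otimes 2}$, and $\lambda_{n+2}=1_{\mathcal H}^{\otimes n}\otimes\lambda_2$ for $n\ge 1$. Let $\mathcal H_0=\mathbb C$ and, for $n\ge1$, let $\mathcal H_n$ be the Hilbert space obtained from $\mathcal H^{\otimes n}$ with the semi-inner product $\langle F,\lambda_nG\rangle_{\otimes n}$ (quotient by the null vectors, then completion). The $(\mathbf q,2)$-Fock space is the Hilbert space direct sum $\Gamma_{q,2}(\mathcal H)=\bigoplus_{n\ge0}\mathcal H_n$, with vacuum vector $\Phi=1\oplus0\oplus0\oplus\cdots$. For $f\in\mathcal H$ let $A^+(f)$ be the bounded operator with $A^+(f)\Phi=f$ and $A^+(f)F=f\otimes F$ for $F\in\mathcal H_n$, $n\ge1$; let $A(f)=A^+(f)^*$ and $Q(f)=A(f)+A^+(f)$. The (vacuum) distribution of a bounded self-adjoint operator $T$ on $\Gamma_{q,2}(\mathcal H)$ is the unique compactly supported probability measure $\mu$ on $\mathbb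 R$ with $\int x^n\,\mu(dx)=\langle\Phi,T^n\Phi\rangle$ for all $n\ge0$. For $a\in(1,2]$ let $$a_1=\frac{\sqrt{(a+2)^2+\frac4{a-1}}+a+2}{8},\qquad a_2=\frac{\sqrt{(a+2)^2+\frac4{a-1}}-a-2}{8},$$ $$A_1=16(a-1)-\frac{2a}{a_1+a_2}\left(\sqrt{\frac{a_2+1}{a_2}}-\sqrt{\frac{a_1-1}{a_1}}\right),$$ $$g_a(x)=\frac{\sqrt{1-x}}{\sqrt x\left(x^2-\frac{a+2}4x-\frac1{16(a-1)}\right)}\,\chi_{(0,1)}(x),\qquad S_a(x)=\frac{2-a+a\sqrt{1-x}}{2-a+a\sqrt{1-x}-\frac x2},$$ and let $\mu_a$ be the measure on $\mathbb R$ $$\mu_a(dx)=\frac{a}{8\pi(a-1)}\,(-g_a(x))\,dx+\frac{A_1}{16(a-1)}\,\delta_{a_1}(dx).$$ **Theorem.** Let $q\in(0,1]$, $a=1+q\in(1,2]$, and let $f\in\mathcal H$ with $\|f\|=\frac12$. Then: 1. for every $t\in(-1,1)$, with $t\ne 1/a_1$ in the case $a>\frac32$, the function $x\mapsto\frac1{1-tx}$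 is $\mu_a$-integrable and $$\int\frac{\mu_a(dx)}{1-tx}=S_a(t);$$ 2. $\mu_a$ is the distribution of $Q(f)^2$ in the vacuum state $\langle\Phi,\cdot\,\Phi\rangle$. -/

import Mathlib

open scoped TensorProduct InnerProductSpace
open MeasureTheory

noncomputable section

namespace QFock

universe u

/-! ### Algebraic tensor powers of `H` as (pre-)Hilbert spaces -/

/-- A complex inner product space, bundled (used only to define tensor powers by recursion). -/
structure InnerSp : Type (u + 1) where
  carrier : Type u
  [normed : NormedAddCommGroup carrier]
  [inner : InnerProductSpace ℂ carrier]

attribute [instance] InnerSp.normed InnerSp.inner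

/-- `tpow H n` is the algebraic tensor power `H^{⊗(n+1)} = H ⊗ (H ⊗ (⋯ ⊗ H))` with its standard
scalar product `⟨f₁ ⊗ ⋯ ⊗ fₖ, g₁ ⊗ ⋯ ⊗ gₖ⟩ = ∏ ⟨fᵢ, gᵢ⟩`. -/
def tpow (H : Type u) [NormedAddCommGroup H] [InnerProductSpace ℂ H] : ℕ → InnerSp.{u}
  | 0 => ⟨H⟩
  | n + 1 => ⟨H ⊗[ℂ] (tpow H n).carrier⟩

variable (H : Type u) [NormedAddCommGroup H] [InnerProductSpace ℂ H]

/-- The space `H^{⊗(n+1)}`. -/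
abbrev TPow (n : ℕ) : Type u := (tpow H n).carrier

/-- The creation of a tensor factor on the left, `F ↦ f ⊗ F`, from `H^{⊗(n+1)}` to
`H^{⊗(n+2)}`. -/
def tmulLeft (f : H) (n : ℕ) : TPow H n →ₗ[ℂ] TPow H (n + 1) :=
  TensorProduct.mk ℂ H (TPow H n) f

/-- The operators `λ`: `lam H q n` is `λ_{n+1}` acting on `H^{⊗(n+1)}`. So `λ_1 = 1`,
`λ_2 (f ⊗ g) = f ⊗ g + q g ⊗ f` and `λ_{n+3} = 1_H ⊗ λ_{n+2}`, that is
`λ_{n+2} = 1_H^{⊗ n} ⊗ λ_2`. -/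
def lam (q : ℝ) : (n : ℕ) → TPow H n →ₗ[ℂ] TPow H n
  | 0 => LinearMap.id
  | 1 => (LinearMap.id : H ⊗[ℂ] H →ₗ[ℂ] H ⊗[ℂ] H) +
      (q : ℂ) • (TensorProduct.comm ℂ H H).toLinearMap
  | n + 2 => (lam q (n + 1)).lTensor H

/-! ### Positivity of the operators `λ` -/

/-- The exchange of the last two factors of `H^{⊗(n+2)}`. -/
def flip : (n : ℕ) → TPow H (n + 1) →ₗᵢ[ℂ] TPow H (n + 1)
  | 0 => (TensorProduct.commIsometry ℂ H H).toLinearIsometry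
  | n + 1 => (flip n).lTensor H

lemma lam_succ (q : ℝ) (n : ℕ) :
    lam H q (n + 1) = LinearMap.id + (q : ℂ) • (flip H n).toLinearMap := by
  induction n with
  | zero => rfl
  | succ n ih =>
    have h : lam H q (n + 1 + 1) = (lam H q (n + 1)).lTensor H := rfl
    rw [h, ih, LinearMap.lTensor_add, LinearMap.lTensor_smul, LinearMap.lTensor_id]
    rfl

lemma flip_flip (n : ℕ) (x : TPow H (n + 1)) : flip H n (flip H n x) = x := by
  induction n with
  | zero => exact (TensorProduct.comm ℂ H H).symm_apply_apply x
  | succ n ih =>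
    have h : (flip H n).toLinearMap ∘ₗ (flip H n).toLinearMap = LinearMap.id :=
      LinearMap.ext ih
    have h' : (flip H n).toLinearMap.lTensor H ∘ₗ (flip H n).toLinearMap.lTensor H
        = LinearMap.id := by
      rw [← LinearMap.lTensor_comp, h, LinearMap.lTensor_id]
    exact LinearMap.congr_fun h' x

lemma inner_flip (n : ℕ) (x y : TPow H (n + 1)) :
    inner ℂ (flip H n x) y = inner ℂ x (flip H n y) := by
  rw [← (flip H n).inner_map_map x, flip_flip]

lemma lam_succ_apply (q : ℝ) (n : ℕ) (x : TPow H (n + 1)) :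
    lam H q (n + 1) x = x + (q : ℂ) • flip H n x := by
  rw [lam_succ]; rfl

lemma lam_symm (q : ℝ) (n : ℕ) (x y : TPow H n) :
    inner ℂ (lam H q n x) y = inner ℂ x (lam H q n y) := by
  cases n with
  | zero => rfl
  | succ n =>
    rw [lam_succ_apply, lam_succ_apply, inner_add_left, inner_add_right, inner_smul_left,
      inner_smul_right, inner_flip, Complex.conj_ofReal]

lemma lam_nonneg (q : Set.Icc (-1 : ℝ) 1) (n : ℕ) (x : TPow H n) :
    0 ≤ (inner ℂ x (lam H q n x)).re := by
  cases n with
  | zero => exact inner_self_nonneg (𝕜 := ℂ) (x := x)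
  | succ n =>
    have h1 : |(inner ℂ x (flip H n x)).re| ≤ ‖x‖ * ‖x‖ :=
      (Complex.abs_re_le_norm _).trans <|
        (norm_inner_le_norm _ _).trans_eq (by rw [LinearIsometry.norm_map])
    have h2 : (inner ℂ x x).re = ‖x‖ * ‖x‖ := by
      have := inner_self_eq_norm_mul_norm (𝕜 := ℂ) x
      simpa using this
    have h3 : |(q : ℝ) * (inner ℂ x (flip H n x)).re| ≤ ‖x‖ * ‖x‖ := by
      rw [abs_mul]
      have hq : |(q : ℝ)| ≤ 1 := abs_le.2 q.2
      nlinarith [abs_nonneg (inner ℂ x (flip H n x)).re, abs_nonneg (q : ℝ)]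
    rw [lam_succ_apply, inner_add_right, inner_smul_right, Complex.add_re,
      Complex.re_ofReal_mul, h2]
    linarith [(abs_le.1 h3).1]

/-! ### The `n`-particle spaces -/

/-- `H^{⊗(n+1)}` equipped with the semi-inner product `⟨F, G⟩_{n+1} = ⟨F, λ_{n+1} G⟩`. -/
def PrePart (_q : Set.Icc (-1 : ℝ) 1) (n : ℕ) : Type u := TPow H n

variable (q : Set.Icc (-1 : ℝ) 1)

instance (n : ℕ) : AddCommGroup (PrePart H q n) := inferInstanceAs (AddCommGroup (TPow H n))
instance (n : ℕ) : Module ℂ (PrePart H q n) := inferInstanceAs (Module ℂ (TPow H n))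

/-- The identity map from `H^{⊗(n+1)}` to the same space with the deformed scalar product. -/
def toPre (n : ℕ) : TPow H n ≃ₗ[ℂ] PrePart H q n := LinearEquiv.refl ℂ (TPow H n)

/-- The semi-inner product `⟨F, G⟩_{n+1} = ⟨F, λ_{n+1} G⟩`. -/
@[reducible] def preCore (n : ℕ) : PreInnerProductSpace.Core ℂ (PrePart H q n) where
  inner F G := inner ℂ ((toPre H q n).symm F) (lam H q n ((toPre H q n).symm G))
  conj_inner_symm F G := by rw [inner_conj_symm, lam_symm]
  re_inner_nonneg F := lam_nonneg H q n _
  add_left F G K := by rw [map_add, inner_add_left]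
  smul_left F G r := by rw [map_smul, inner_smul_left]

instance (n : ℕ) : SeminormedAddCommGroup (PrePart H q n) :=
  @InnerProductSpace.Core.toSeminormedAddCommGroup ℂ (PrePart H q n) _ _ _ (preCore H q n)

instance (n : ℕ) : InnerProductSpace ℂ (PrePart H q n) :=
  InnerProductSpace.ofCore (preCore H q n)

lemma inner_toPre (n : ℕ) (F G : TPow H n) :
    inner ℂ (toPre H q n F) (toPre H q n G) = inner ℂ F (lam H q n G) := rfl

/-- The `(n+1)`-particle space `H_{n+1}`: the Hausdorff completion of `H^{⊗(n+1)}` for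
`⟨·, ·⟩_{n+1}`, i.e. the completion of its quotient by the vectors of seminorm zero. -/
abbrev Particle (n : ℕ) : Type u := UniformSpace.Completion (PrePart H q n)

/-- The `(q,2)`-Fock space `Γ = ℂ ⊕ H_1 ⊕ H_2 ⊕ ⋯` (Hilbert space direct sum). An element is a pair
of its component in `H_0 = ℂ` and the sequence of its components in `H_1, H_2, …`. -/
abbrev Fock : Type u := WithLp 2 (ℂ × lp (fun n : ℕ => Particle H q n) 2)

/-- The vacuum vector `Φ = 1 ⊕ 0 ⊕ 0 ⊕ ⋯`. -/
def vacuum : Fock H q := WithLp.toLp 2 (1, 0)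

/-! ### Creation and annihilation operators -/

variable {H}

lemma norm_sq_toPre (n : ℕ) (F : TPow H n) :
    ‖toPre H q n F‖ ^ 2 = (inner ℂ F (lam H q n F)).re := by
  rw [← inner_toPre]
  exact norm_sq_eq_re_inner (𝕜 := ℂ) _

lemma norm_tmulLeft_zero (f : H) (F : TPow H 0) :
    (inner ℂ (tmulLeft H f 0 F) (lam H q 1 (tmulLeft H f 0 F))).re
      ≤ (2 * ‖f‖) ^ 2 * (inner ℂ F (lam H q 0 F)).re := by
  have key (g : H) : (inner ℂ (E := H ⊗[ℂ] H) (f ⊗ₜ[ℂ] g)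
      (f ⊗ₜ[ℂ] g + ((q : ℝ) : ℂ) • (g ⊗ₜ[ℂ] f))).re ≤ (2 * ‖f‖) ^ 2 * (inner ℂ g g).re := by
    have hq : |(q : ℝ)| ≤ 1 := abs_le.2 q.2
    have h4 : 0 ≤ ‖f‖ * ‖g‖ := mul_nonneg (norm_nonneg _) (norm_nonneg _)
    have h3 : ‖(f ⊗ₜ[ℂ] g + ((q : ℝ) : ℂ) • (g ⊗ₜ[ℂ] f) : H ⊗[ℂ] H)‖ ≤ 2 * (‖f‖ * ‖g‖) := by
      refine (norm_add_le _ _).trans ?_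
      rw [norm_smul, TensorProduct.norm_tmul, TensorProduct.norm_tmul, Complex.norm_real,
        Real.norm_eq_abs, mul_comm ‖g‖ ‖f‖]
      nlinarith
    have h0 : (inner ℂ g g).re = ‖g‖ ^ 2 := (norm_sq_eq_re_inner (𝕜 := ℂ) g).symm
    refine (Complex.re_le_norm _).trans <|
      (norm_inner_le_norm (𝕜 := ℂ) (E := H ⊗[ℂ] H) _ _).trans ?_
    rw [TensorProduct.norm_tmul, h0]
    nlinarith
  exact key F

lemma norm_tmulLeft_succ (f : H) (n : ℕ) (F : TPow H (n + 1)) :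
    (inner ℂ (tmulLeft H f (n + 1) F) (lam H q (n + 2) (tmulLeft H f (n + 1) F))).re
      ≤ (2 * ‖f‖) ^ 2 * (inner ℂ F (lam H q (n + 1) F)).re := by
  have h1 : inner ℂ (tmulLeft H f (n + 1) F) (lam H q (n + 2) (tmulLeft H f (n + 1) F))
      = inner ℂ f f * inner ℂ F (lam H q (n + 1) F) := rfl
  have h2 : inner ℂ f f = ((‖f‖ ^ 2 : ℝ) : ℂ) := by
    rw [inner_self_eq_norm_sq_to_K]; norm_cast
  rw [h1, h2, Complex.re_ofReal_mul]
  have h3 := lam_nonneg H q (n + 1) F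
  nlinarith [mul_nonneg (sq_nonneg ‖f‖) h3]

lemma norm_tmulLeft_le (f : H) (n : ℕ) (F : TPow H n) :
    ‖toPre H q (n + 1) (tmulLeft H f n F)‖ ≤ 2 * ‖f‖ * ‖toPre H q n F‖ := by
  refine le_of_sq_le_sq ?_ (by positivity)
  rw [mul_pow, norm_sq_toPre, norm_sq_toPre]
  cases n with
  | zero => exact norm_tmulLeft_zero q f F
  | succ n => exact norm_tmulLeft_succ q f n F

/-- The map `F ↦ f ⊗ F` before completion. -/
def preCreate (f : H) (n : ℕ) : PrePart H q n →L[ℂ] PrePart H q (n + 1) :=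
  LinearMap.mkContinuous
    ((toPre H q (n + 1)).toLinearMap ∘ₗ tmulLeft H f n ∘ₗ (toPre H q n).symm.toLinearMap)
    (2 * ‖f‖) (fun F => norm_tmulLeft_le q f n ((toPre H q n).symm F))

/-- The creation operator from the `(n+1)`-particle space to the `(n+2)`-particle space: the
continuous extension of `F ↦ f ⊗ F`. -/
def createPart (f : H) (n : ℕ) : Particle H q n →L[ℂ] Particle H q (n + 1) :=
  (preCreate q f n).completion

lemma norm_createPart_le (f : H) (n : ℕ) (x : Particle H q n) :
    ‖createPart q f n x‖ ≤ 2 * ‖f‖ * ‖x‖ := by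
  induction x using UniformSpace.Completion.induction_on with
  | hp => exact isClosed_le (by fun_prop) (by fun_prop)
  | ih a =>
    rw [createPart, ContinuousLinearMap.completion_apply_coe, UniformSpace.Completion.norm_coe,
      UniformSpace.Completion.norm_coe]
    exact norm_tmulLeft_le q f n ((toPre H q n).symm a)

/-- The vector `f` seen as an element of the one-particle space `H_1`. -/
def onePart (f : H) : Particle H q 0 := ((toPre H q 0 f : PrePart H q 0) : Particle H q 0)

/-- The components of `A⁺(f) (c ⊕ x_1 ⊕ x_2 ⊕ ⋯)` in `H_1, H_2, …`: the component in `H_1` is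
`c f`, and that in `H_{n+2}` is `f ⊗ x_{n+1}`. -/
def createSeq (f : H) (c : ℂ) (x : (n : ℕ) → Particle H q n) : (n : ℕ) → Particle H q n
  | 0 => c • onePart q f
  | n + 1 => createPart q f n (x n)

lemma summable_createSeq (f : H) (c : ℂ) (x : lp (fun n : ℕ => Particle H q n) 2) :
    Summable fun n => ‖createSeq q f c x n‖ ^ 2 := by
  have hx : Summable fun n => ‖x n‖ ^ 2 := by
    have := (lp.memℓp x).summable (by norm_num)
    simpa using this
  refine (summable_nat_add_iff 1).1 ?_
  refine Summable.of_nonneg_of_le (fun _ => sq_nonneg _) (fun n => ?_)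
    (hx.mul_left ((2 * ‖f‖) ^ 2))
  rw [← mul_pow]
  exact pow_le_pow_left₀ (norm_nonneg _) (norm_createPart_le q f n (x n)) 2

lemma memlp_createSeq (f : H) (c : ℂ) (x : lp (fun n : ℕ => Particle H q n) 2) :
    Memℓp (createSeq q f c x) 2 := by
  refine memℓp_gen ?_
  simpa using summable_createSeq q f c x

/-- The creation operator as a linear map on the Fock space. -/
def createLin (f : H) : Fock H q →ₗ[ℂ] Fock H q where
  toFun x := WithLp.toLp 2 (0, ⟨createSeq q f x.fst x.snd, memlp_createSeq q f x.fst x.snd⟩)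
  map_add' x y := by
    apply (WithLp.equiv 2 _).injective
    refine Prod.ext (by simp) (lp.ext (funext fun n => ?_))
    cases n with
    | zero => exact add_smul _ _ _
    | succ n => exact map_add (createPart q f n) _ _
  map_smul' c x := by
    apply (WithLp.equiv 2 _).injective
    refine Prod.ext (by simp) (lp.ext (funext fun n => ?_))
    cases n with
    | zero => exact mul_smul _ _ _
    | succ n => exact map_smul (createPart q f n) _ _

lemma norm_createLin_le (f : H) (x : Fock H q) :
    ‖createLin q f x‖ ≤ 2 * ‖f‖ * ‖x‖ := by
  refine le_of_sq_le_sq ?_ (by positivity)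
  have hsum (y : lp (fun n : ℕ => Particle H q n) 2) : HasSum (fun n => ‖y n‖ ^ 2) (‖y‖ ^ 2) := by
    have := lp.hasSum_norm (p := 2) (by norm_num) y
    simpa using this
  have h0 : ‖onePart q f‖ = ‖f‖ := by
    rw [onePart, UniformSpace.Completion.norm_coe]
    have h1 := norm_sq_toPre q 0 (f : TPow H 0)
    have h2 : (inner ℂ f f).re = ‖f‖ ^ 2 := (norm_sq_eq_re_inner (𝕜 := ℂ) f).symm
    exact (sq_eq_sq₀ (norm_nonneg _) (norm_nonneg _)).1 (h1.trans h2)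
  set y : lp (fun n : ℕ => Particle H q n) 2 :=
    ⟨createSeq q f x.fst x.snd, memlp_createSeq q f x.fst x.snd⟩ with hy
  have h1 : ‖createLin q f x‖ ^ 2 = ‖y‖ ^ 2 := by
    rw [WithLp.prod_norm_sq_eq_of_L2]
    change ‖(0 : ℂ)‖ ^ 2 + ‖y‖ ^ 2 = _
    simp
  have h2 : ‖y‖ ^ 2 = ‖y 0‖ ^ 2 + ∑' n, ‖y (n + 1)‖ ^ 2 := by
    rw [← (hsum y).tsum_eq, (hsum y).summable.tsum_eq_zero_add]
  have h3 : ∑' n, ‖y (n + 1)‖ ^ 2 ≤ (2 * ‖f‖) ^ 2 * ‖x.snd‖ ^ 2 := by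
    rw [← (hsum x.snd).tsum_eq, ← tsum_mul_left]
    refine Summable.tsum_le_tsum (fun n => ?_) ((summable_nat_add_iff 1).2 (hsum y).summable)
      ((hsum x.snd).summable.mul_left _)
    rw [← mul_pow]
    exact pow_le_pow_left₀ (norm_nonneg _) (norm_createPart_le q f n (x.snd n)) 2
  have h4 : ‖y 0‖ ^ 2 = ‖x.fst‖ ^ 2 * ‖f‖ ^ 2 := by
    change ‖x.fst • onePart q f‖ ^ 2 = _
    rw [norm_smul, h0, mul_pow]
  rw [h1, h2, h4, mul_pow, WithLp.prod_norm_sq_eq_of_L2]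
  nlinarith [mul_nonneg (sq_nonneg ‖x.fst‖) (sq_nonneg ‖f‖)]

/-- The creation operator `A⁺(f)` on the `(q,2)`-Fock space, the bounded operator with
`A⁺(f) Φ = f` and `A⁺(f) F = f ⊗ F` on each `n`-particle space. -/
def create (f : H) : Fock H q →L[ℂ] Fock H q :=
  (createLin q f).mkContinuous (2 * ‖f‖) (norm_createLin_le q f)

/-- The annihilation operator `A(f) = A⁺(f)*`. -/
def annihilate (f : H) : Fock H q →L[ℂ] Fock H q := ContinuousLinearMap.adjoint (create q f)

/-- The field operator `Q(f) = A(f) + A⁺(f)`. -/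
def field (f : H) : Fock H q →L[ℂ] Fock H q := annihilate q f + create q f

end QFock

/-! ### Vacuum distributions -/

/-- `μ` is the distribution of the bounded self-adjoint operator `T` in the vector state
`⟨Φ, · Φ⟩`: the (unique) compactly supported probability measure on `ℝ` whose moments are
`⟨Φ, Tⁿ Φ⟩`. -/
structure IsDistribution {K : Type*} [NormedAddCommGroup K] [InnerProductSpace ℂ K]
    [CompleteSpace K] (T : K →L[ℂ] K) (Φ : K) (μ : Measure ℝ) : Prop where
  isSelfAdjoint : IsSelfAdjoint T
  isProbability : IsProbabilityMeasure μ
  compact_support : ∃ C : Set ℝ, IsCompact C ∧ μ Cᶜ = 0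
  moment (n : ℕ) : inner ℂ Φ ((T ^ n) Φ) = ((∫ x, x ^ n ∂μ : ℝ) : ℂ)

/-! ### The measure `μ_a` -/

namespace QFock

/-- `S_a(x)`, the moment-generating function of `Q(f)²` for `‖f‖ = 1/2`. -/
def S (a x : ℝ) : ℝ :=
  (2 - a + a * √(1 - x)) / (2 - a + a * √(1 - x) - x / 2)

/-- The function `g_a`. -/
def g (a : ℝ) : ℝ → ℝ :=
  (Set.Ioo 0 1).indicator fun x =>
    √(1 - x) / (√x * (x ^ 2 - (a + 2) / 4 * x - 1 / (16 * (a - 1))))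

/-- The number `a_1`, the location of the atom of `μ_a`. -/
def a₁ (a : ℝ) : ℝ := (√((a + 2) ^ 2 + 4 / (a - 1)) + a + 2) / 8

/-- The number `a_2`. -/
def a₂ (a : ℝ) : ℝ := (√((a + 2) ^ 2 + 4 / (a - 1)) - a - 2) / 8

/-- The number `A_1`. -/
def A₁ (a : ℝ) : ℝ :=
  16 * (a - 1) - 2 * a / (a₁ a + a₂ a) * (√((a₂ a + 1) / a₂ a) - √((a₁ a - 1) / a₁ a))

/-- The measure `μ_a(dx) = a / (8π(a-1)) (-g_a(x)) dx + A_1 / (16(a-1)) δ_{a_1}(dx)` on `ℝ`,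
for `1 < a ≤ 2` (where `-g_a ≥ 0` and `A_1 ≥ 0`). -/
def muMeasure (a : ℝ) : Measure ℝ :=
  volume.withDensity (fun x => ENNReal.ofReal (a / (8 * Real.pi * (a - 1)) * (-g a x))) +
    ENNReal.ofReal (A₁ a / (16 * (a - 1))) • Measure.dirac (a₁ a)

end QFock

end

/-! ### Integrals of the weight √((1 - x)/x) against rational functions. -/

section ArcsineIntegrals

open Set intervalIntegral

/-! Both halves rest on one function: `S a` is the integral of 1/(1 - tx) against μ_a, and near t =
0 it is also the moment generating function of Q(f)² in the vacuum. Comparing Taylor coefficients at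
0 then identifies the moments.

Measure side. The quadratic in `g a` has roots a₁ and -a₂, with 1/a₁ = 1 - s² and -1/a₂ = 1 - r²,
where s = |a - d|, r = a + d and d² = (a + 3)(a - 1). With t = 1 - τ², partial fractions reduce the
continuous part to ∫ √((1 - x)/x)/(1 - px) dx, which an arcsine substitution evaluates
(`mul_integral_weight_div`). The outcome is a symmetric rational function of s, r, τ. Adding the
atom gives `stieltjes_identity`: the denominator τ² + 2aτ + 3 - 2a of `S a` vanishes at τ = d - a,
which is positive exactly when a > 3/2, and the atom supplies that pole; for a ≤ 3/2 its mass is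
zero.

Fock side. The vectors eₙ = A⁺(f)ⁿΦ satisfy A(f)eₙ₊₁ = cₙeₙ with weights 1/4, (1 + q)/4, 1/4, 1/4,
…, so Q(f)² acts on the even eₙ by a three-term recurrence that is constant from e₄ on. Under t =
4w/(1 + w)² a geometric sequence (4w)ⁿ solves it, and correcting the e₀ coefficient yields an
explicit multiple of (1 - tQ(f)²)⁻¹Φ (`resolventVector_eq`). A Neumann series reads off the
generating function. -/

lemma one_sub_mul_pos {p x : ℝ} (hp : p ≤ 1) (hx : x ∈ Ioo (0 : ℝ) 1) : 0 < 1 - p * x := by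
  nlinarith [hx.1, hx.2]

lemma one_sub_mul_pos_of_lt {p x : ℝ} (hp : p < 1) (hx : x ∈ Icc (0 : ℝ) 1) : 0 < 1 - p * x := by
  rcases le_or_gt p 0 with h | h <;> nlinarith [hx.1, hx.2]

/-- The Möbius map increases from -1 to 1 on [0, 1], so it pulls the arcsine law of [-1, 1] back to
this density; hence its total integral is π for every p < 1. -/
lemma hasDerivAt_arcsin_moebius {p x : ℝ} (hp : p < 1) (hx : x ∈ Ioo (0 : ℝ) 1) :
    HasDerivAt (fun y : ℝ => Real.arcsin (((2 - p) * y - 1) / (1 - p * y)))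
      (√(1 - p) / ((1 - p * x) * (√x * √(1 - x)))) x := by
  have h0 := one_sub_mul_pos hp.le hx
  have hx0 := hx.1
  have hx1 : 0 < 1 - x := sub_pos.2 hx.2
  have hp1 : 0 < 1 - p := sub_pos.2 hp
  have hd : HasDerivAt (fun y : ℝ => ((2 - p) * y - 1) / (1 - p * y))
      ((2 * (1 - p)) / (1 - p * x) ^ 2) x := by
    have h1 : HasDerivAt (fun y : ℝ => (2 - p) * y - 1) (2 - p) x := by
      simpa using ((hasDerivAt_id x).const_mul (2 - p)).sub_const 1
    have h2 : HasDerivAt (fun y : ℝ => 1 - p * y) (-p) x := by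
      simpa using ((hasDerivAt_id x).const_mul p).const_sub 1
    refine (h1.div h2 h0.ne').congr_deriv ?_
    congr 1
    ring
  have hsq : 1 - (((2 - p) * x - 1) / (1 - p * x)) ^ 2
      = (2 * (√x * √(1 - x)) * √(1 - p) / (1 - p * x)) ^ 2 := by
    simp only [div_pow, mul_pow, Real.sq_sqrt hx0.le, Real.sq_sqrt hx1.le, Real.sq_sqrt hp1.le]
    field_simp
    ring
  have hpos : 0 < 2 * (√x * √(1 - x)) * √(1 - p) / (1 - p * x) := by positivity
  have hlt : (((2 - p) * x - 1) / (1 - p * x)) ^ 2 < 1 := by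
    have := pow_pos hpos 2
    linarith
  have hne := abs_lt.1 ((sq_lt_one_iff_abs_lt_one _).1 hlt)
  refine ((Real.hasDerivAt_arcsin hne.1.ne' hne.2.ne).comp x hd).congr_deriv ?_
  rw [hsq, Real.sqrt_sq hpos.le]
  have h2 := Real.sq_sqrt hp1.le
  have h3 : 0 < √(1 - p) := Real.sqrt_pos.2 hp1
  field_simp
  rw [h2]

lemma continuousOn_arcsin_moebius {p : ℝ} (hp : p < 1) :
    ContinuousOn (fun y : ℝ => Real.arcsin (((2 - p) * y - 1) / (1 - p * y))) (Icc 0 1) := by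
  refine Real.continuous_arcsin.comp_continuousOn ?_
  refine ContinuousOn.div (by fun_prop) (by fun_prop) fun x hx => ?_
  exact (one_sub_mul_pos_of_lt hp hx).ne'

lemma intervalIntegrable_arcsine {p : ℝ} (hp : p < 1) :
    IntervalIntegrable (fun x : ℝ => √(1 - p) / ((1 - p * x) * (√x * √(1 - x)))) volume 0 1 := by
  -- The density is unbounded at the endpoints, but a nonnegative derivative of a continuous
  -- function is integrable.
  refine intervalIntegrable_deriv_of_nonneg
    (g := fun y : ℝ => Real.arcsin (((2 - p) * y - 1) / (1 - p * y))) ?_ ?_ ?_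
  · rw [uIcc_of_le zero_le_one]
    exact continuousOn_arcsin_moebius hp
  · simp only [zero_le_one, inf_of_le_left, sup_of_le_right]
    exact fun x hx => hasDerivAt_arcsin_moebius hp hx
  · simp only [zero_le_one, inf_of_le_left, sup_of_le_right]
    intro x hx
    have := one_sub_mul_pos hp.le hx
    positivity

lemma integral_arcsine {p : ℝ} (hp : p < 1) :
    ∫ x in (0 : ℝ)..1, √(1 - p) / ((1 - p * x) * (√x * √(1 - x))) = Real.pi := by
  rw [integral_eq_sub_of_hasDerivAt_of_le zero_le_one (continuousOn_arcsin_moebius hp)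
    (fun x hx => hasDerivAt_arcsin_moebius hp hx) (intervalIntegrable_arcsine hp)]
  have : (2 - p - 1) / (1 - p) = 1 := by
    rw [div_eq_one_iff_eq (sub_pos.2 hp).ne']
    ring
  simp [this]

/-- The weight `√((1 - x) / x)` on `(0, 1)`. -/
noncomputable def marchenkoWeight (x : ℝ) : ℝ := √(1 - x) / √x

lemma intervalIntegrable_weight_div {p : ℝ} (hp : p ≤ 1) :
    IntervalIntegrable (fun x => marchenkoWeight x / (1 - p * x)) volume 0 1 := by
  have h := intervalIntegrable_arcsine zero_lt_one
  rw [intervalIntegrable_iff_integrableOn_Ioo_of_le zero_le_one] at h ⊢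
  refine h.mono' ?_ ?_
  · refine Measurable.aestronglyMeasurable ?_
    unfold marchenkoWeight
    fun_prop
  · refine (ae_restrict_iff' measurableSet_Ioo).2 (Filter.Eventually.of_forall fun x hx => ?_)
    have h0 := one_sub_mul_pos hp hx
    have hx0 : 0 < √x := Real.sqrt_pos.2 hx.1
    have hx1 : 0 < 1 - x := sub_pos.2 hx.2
    have hx2 : 0 < √(1 - x) := Real.sqrt_pos.2 hx1
    -- This bounds the integrand by the arcsine density with parameter 0.
    have hle : 1 - x ≤ 1 - p * x := by nlinarith [hx.1]
    have h4 := Real.mul_self_sqrt hx1.le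
    rw [marchenkoWeight, Real.norm_of_nonneg (by positivity), div_div, sub_zero, Real.sqrt_one,
      zero_mul, sub_zero, one_mul, div_le_div_iff₀ (by positivity) (by positivity)]
    calc √(1 - x) * (√x * √(1 - x)) = √x * (√(1 - x) * √(1 - x)) := by ring
      _ = √x * (1 - x) := by rw [h4]
      _ ≤ √x * (1 - p * x) := by gcongr
      _ = _ := by ring

/-- Since p(1 - x)/(1 - px) = 1 - (1 - p)/(1 - px), the integrand is a difference of two arcsine
densities, with parameters 0 and p. The factor p on the left avoids dividing by zero at p = 0. The
value p = 1, reached by μ_a at a = 3/2, is separate because the arcsine lemma needs p < 1. -/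
lemma mul_integral_weight_div {p : ℝ} (hp : p ≤ 1) :
    p * ∫ x in (0 : ℝ)..1, marchenkoWeight x / (1 - p * x) = Real.pi * (1 - √(1 - p)) := by
  have hI0 := intervalIntegrable_arcsine zero_lt_one
  have hE0 := integral_arcsine zero_lt_one
  rw [← intervalIntegral.integral_const_mul]
  rcases hp.lt_or_eq with hp | rfl
  · have hI := (intervalIntegrable_arcsine hp).const_mul (√(1 - p))
    have hE := integral_arcsine hp
    have hp1 : 0 < 1 - p := sub_pos.2 hp
    have key : ∫ x in (0 : ℝ)..1, p * (marchenkoWeight x / (1 - p * x))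
        = ∫ x in (0 : ℝ)..1, (√(1 - 0) / ((1 - 0 * x) * (√x * √(1 - x)))
          - √(1 - p) * (√(1 - p) / ((1 - p * x) * (√x * √(1 - x))))) := by
      refine integral_congr_Ioo_of_le zero_le_one fun x hx => ?_
      have h0 := one_sub_mul_pos hp.le hx
      have hx1 : 0 < 1 - x := sub_pos.2 hx.2
      have hx0 : 0 < √x := Real.sqrt_pos.2 hx.1
      have hx2 : 0 < √(1 - x) := Real.sqrt_pos.2 hx1
      have h4 := Real.sq_sqrt hx1.le
      have h5 := Real.sq_sqrt hp1.le
      simp only [marchenkoWeight, sub_zero, Real.sqrt_one, zero_mul, one_mul]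
      field_simp
      rw [h4, h5]
      ring
    rw [key, intervalIntegral.integral_sub hI0 hI, intervalIntegral.integral_const_mul, hE, hE0]
    ring
  · have key : ∫ x in (0 : ℝ)..1, 1 * (marchenkoWeight x / (1 - 1 * x))
        = ∫ x in (0 : ℝ)..1, √(1 - 0) / ((1 - 0 * x) * (√x * √(1 - x))) := by
      refine integral_congr_Ioo_of_le zero_le_one fun x hx => ?_
      have hx1 : 0 < 1 - x := sub_pos.2 hx.2
      have hx0 : 0 < √x := Real.sqrt_pos.2 hx.1
      have hx2 : 0 < √(1 - x) := Real.sqrt_pos.2 hx1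
      have h4 := Real.sq_sqrt hx1.le
      simp only [marchenkoWeight, sub_zero, Real.sqrt_one, zero_mul, one_mul]
      field_simp
      rw [h4]
    rw [key, hE0]
    simp

lemma intervalIntegrable_weight_div_two {p r : ℝ} (hp : p ≤ 1) (hr : r < 1) :
    IntervalIntegrable (fun x => marchenkoWeight x / ((1 - p * x) * (1 - r * x))) volume 0 1 := by
  have h := (intervalIntegrable_weight_div hp).mul_continuousOn (g := fun x => (1 - r * x)⁻¹)
    (by
      rw [uIcc_of_le zero_le_one]
      exact ContinuousOn.inv₀ (by fun_prop) fun x hx => (one_sub_mul_pos_of_lt hr hx).ne')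
  refine h.congr fun x _ => ?_
  rw [← div_div, div_eq_mul_inv _ (1 - r * x)]

lemma intervalIntegrable_weight_div_three {p r t : ℝ} (hp : p ≤ 1) (hr : r < 1) (ht : t < 1) :
    IntervalIntegrable
      (fun x => marchenkoWeight x / ((1 - p * x) * (1 - r * x)) * (1 / (1 - t * x)))
      volume 0 1 := by
  refine (intervalIntegrable_weight_div_two hp hr).mul_continuousOn ?_
  rw [uIcc_of_le zero_le_one]
  exact ContinuousOn.div (by fun_prop) (by fun_prop) fun x hx => (one_sub_mul_pos_of_lt ht hx).ne'

lemma partial_fractions_three {p r t x : ℝ} (w : ℝ) (hpr : r - p ≠ 0) (hpt : t - p ≠ 0)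
    (hrt : t - r ≠ 0) (hp : 1 - p * x ≠ 0) (hr : 1 - r * x ≠ 0) (ht : 1 - t * x ≠ 0) :
    w / ((1 - p * x) * (1 - r * x)) * (1 / (1 - t * x)) =
      p / ((r - p) * (t - p)) * (p * (w / (1 - p * x)))
        - r / ((r - p) * (t - r)) * (r * (w / (1 - r * x)))
        + t / ((t - p) * (t - r)) * (t * (w / (1 - t * x))) := by
  have hp' : 1 - x * p ≠ 0 := by rwa [mul_comm]
  have hr' : 1 - x * r ≠ 0 := by rwa [mul_comm]
  have ht' : 1 - x * t ≠ 0 := by rwa [mul_comm]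
  field_simp
  ring

/-- Writing each parameter as 1 - σ² turns the square roots √(1 - p) into σ, so partial fractions
give a rational function; the factors s - r, s - τ and r - τ cancel. -/
lemma integral_weight_div_three_of_ne {s r τ : ℝ} (hs : 0 ≤ s) (hr : 0 < r) (hτ : 0 < τ)
    (hsr : s ≠ r) (hsτ : s ≠ τ) (hrτ : r ≠ τ) :
    ∫ x in (0 : ℝ)..1, marchenkoWeight x / ((1 - (1 - s ^ 2) * x) * (1 - (1 - r ^ 2) * x))
        * (1 / (1 - (1 - τ ^ 2) * x))
      = Real.pi * (1 + s * r + s * τ + r * τ) / ((s + r) * (s + τ) * (r + τ)) := by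
  have hs1 : 1 - s ^ 2 ≤ 1 := by nlinarith
  have hr1 : 1 - r ^ 2 < 1 := by nlinarith
  have hτ1 : 1 - τ ^ 2 < 1 := by nlinarith
  have e1 : s ^ 2 - r ^ 2 ≠ 0 := by
    rw [sq_sub_sq]; exact mul_ne_zero (by positivity) (sub_ne_zero.2 hsr)
  have e2 : s ^ 2 - τ ^ 2 ≠ 0 := by
    rw [sq_sub_sq]; exact mul_ne_zero (by positivity) (sub_ne_zero.2 hsτ)
  have e3 : r ^ 2 - τ ^ 2 ≠ 0 := by
    rw [sq_sub_sq]; exact mul_ne_zero (by positivity) (sub_ne_zero.2 hrτ)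
  have d1 := sub_ne_zero.2 hsr
  have d2 := sub_ne_zero.2 hsτ
  have d3 := sub_ne_zero.2 hrτ
  have key : ∫ x in (0 : ℝ)..1,
      marchenkoWeight x / ((1 - (1 - s ^ 2) * x) * (1 - (1 - r ^ 2) * x))
        * (1 / (1 - (1 - τ ^ 2) * x))
      = ∫ x in (0 : ℝ)..1,
        ((1 - s ^ 2) / ((s ^ 2 - r ^ 2) * (s ^ 2 - τ ^ 2))
            * ((1 - s ^ 2) * (marchenkoWeight x / (1 - (1 - s ^ 2) * x)))
          - (1 - r ^ 2) / ((s ^ 2 - r ^ 2) * (r ^ 2 - τ ^ 2))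
            * ((1 - r ^ 2) * (marchenkoWeight x / (1 - (1 - r ^ 2) * x)))
          + (1 - τ ^ 2) / ((s ^ 2 - τ ^ 2) * (r ^ 2 - τ ^ 2))
            * ((1 - τ ^ 2) * (marchenkoWeight x / (1 - (1 - τ ^ 2) * x)))) := by
    refine integral_congr_Ioo_of_le zero_le_one fun x hx => ?_
    have h1 := (one_sub_mul_pos hs1 hx).ne'
    have h2 := (one_sub_mul_pos hr1.le hx).ne'
    have h3 := (one_sub_mul_pos hτ1.le hx).ne'
    rw [show s ^ 2 - r ^ 2 = (1 - r ^ 2) - (1 - s ^ 2) by ring] at e1 ⊢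
    rw [show s ^ 2 - τ ^ 2 = (1 - τ ^ 2) - (1 - s ^ 2) by ring] at e2 ⊢
    rw [show r ^ 2 - τ ^ 2 = (1 - τ ^ 2) - (1 - r ^ 2) by ring] at e3 ⊢
    exact partial_fractions_three _ e1 e2 e3 h1 h2 h3
  have hIs := (intervalIntegrable_weight_div hs1).const_mul (1 - s ^ 2)
  have hIr := (intervalIntegrable_weight_div hr1.le).const_mul (1 - r ^ 2)
  have hIτ := (intervalIntegrable_weight_div hτ1.le).const_mul (1 - τ ^ 2)
  rw [key, intervalIntegral.integral_add ((hIs.const_mul _).sub (hIr.const_mul _))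
      (hIτ.const_mul _),
    intervalIntegral.integral_sub (hIs.const_mul _) (hIr.const_mul _)]
  simp only [intervalIntegral.integral_const_mul, mul_integral_weight_div hs1,
    mul_integral_weight_div hr1.le, mul_integral_weight_div hτ1.le, sub_sub_cancel,
    Real.sqrt_sq hs, Real.sqrt_sq hr.le, Real.sqrt_sq hτ.le]
  simp only [sq_sub_sq]
  have f1 : s + r ≠ 0 := by positivity
  have f2 : s + τ ≠ 0 := by positivity
  have f3 : r + τ ≠ 0 := by positivity
  field_simp
  ring

lemma continuousAt_integral_weight_div_three {p r t : ℝ} (hp : p ≤ 1) (hr : r < 1) (ht : t < 1) :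
    ContinuousAt (fun u => ∫ x in (0 : ℝ)..1,
      marchenkoWeight x / ((1 - p * x) * (1 - r * x)) * (1 / (1 - u * x))) t := by
  -- A lower bound for 1 - ux uniform in u near t and x in (0, 1]; the maximum with 0 covers
  -- negative u.
  set c : ℝ := 1 - max ((1 + t) / 2) 0 with hc
  have hcpos : 0 < c := by
    rw [hc, sub_pos, max_lt_iff]
    constructor <;> linarith
  have hlow : ∀ u < (1 + t) / 2, ∀ x ∈ Ioc (0 : ℝ) 1, c ≤ 1 - u * x := by
    intro u hu x hx
    have h1 : u ≤ max ((1 + t) / 2) 0 := hu.le.trans (le_max_left _ _)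
    have h2 : 0 ≤ max ((1 + t) / 2) 0 := le_max_right _ _
    nlinarith [hx.1, hx.2]
  have hnear : ∀ᶠ u in nhds t, u < (1 + t) / 2 := Iio_mem_nhds (by linarith)
  refine continuousAt_of_dominated_interval
    (bound := fun x => ‖marchenkoWeight x / ((1 - p * x) * (1 - r * x))‖ * (1 / c)) ?_ ?_ ?_ ?_
  · refine Filter.Eventually.of_forall fun u => Measurable.aestronglyMeasurable ?_
    unfold marchenkoWeight
    fun_prop
  · filter_upwards [hnear] with u hu
    refine Filter.Eventually.of_forall fun x hx => ?_
    rw [uIoc_of_le zero_le_one] at hx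
    have := hlow u hu x hx
    rw [norm_mul, Real.norm_of_nonneg (r := 1 / (1 - u * x))
      (one_div_nonneg.2 (hcpos.le.trans this))]
    gcongr
  · exact (intervalIntegrable_weight_div_two hp hr).norm.mul_const _
  · refine Filter.Eventually.of_forall fun x hx => ?_
    rw [uIoc_of_le zero_le_one] at hx
    have : 1 - t * x ≠ 0 := (hcpos.trans_le (hlow t (by linarith) x hx)).ne'
    refine ContinuousAt.mul continuousAt_const (ContinuousAt.div continuousAt_const ?_ this)
    fun_prop

/-- At τ = s or τ = r the partial fractions break down but the final formula does not; both sides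
are continuous in τ, so the punctured neighbourhood determines the value. -/
lemma integral_weight_div_three {s r τ : ℝ} (hs : 0 ≤ s) (hr : 0 < r) (hτ : 0 < τ)
    (hsr : s ≠ r) :
    ∫ x in (0 : ℝ)..1, marchenkoWeight x / ((1 - (1 - s ^ 2) * x) * (1 - (1 - r ^ 2) * x))
        * (1 / (1 - (1 - τ ^ 2) * x))
      = Real.pi * (1 + s * r + s * τ + r * τ) / ((s + r) * (s + τ) * (r + τ)) := by
  have hcont : ContinuousAt (fun σ : ℝ => ∫ x in (0 : ℝ)..1,
      marchenkoWeight x / ((1 - (1 - s ^ 2) * x) * (1 - (1 - r ^ 2) * x))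
        * (1 / (1 - (1 - σ ^ 2) * x))) τ := by
    have h := continuousAt_integral_weight_div_three (p := 1 - s ^ 2) (r := 1 - r ^ 2)
      (t := 1 - τ ^ 2) (by nlinarith) (by nlinarith) (by nlinarith)
    exact ContinuousAt.comp (f := fun σ : ℝ => 1 - σ ^ 2) h (by fun_prop)
  have hcont' : ContinuousAt (fun σ : ℝ =>
      Real.pi * (1 + s * r + s * σ + r * σ) / ((s + r) * (s + σ) * (r + σ))) τ :=
    ContinuousAt.div (by fun_prop) (by fun_prop) (by positivity)
  have hev : ∀ᶠ σ in nhdsWithin τ {τ}ᶜ, ∫ x in (0 : ℝ)..1,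
      marchenkoWeight x / ((1 - (1 - s ^ 2) * x) * (1 - (1 - r ^ 2) * x))
        * (1 / (1 - (1 - σ ^ 2) * x))
      = Real.pi * (1 + s * r + s * σ + r * σ) / ((s + r) * (s + σ) * (r + σ)) := by
    have hne (b : ℝ) : ∀ᶠ σ in nhdsWithin τ {τ}ᶜ, b ≠ σ := by
      rcases eq_or_ne b τ with rfl | hb
      · filter_upwards [self_mem_nhdsWithin] with σ hσ using Ne.symm hσ
      · filter_upwards [nhdsWithin_le_nhds (isOpen_ne.mem_nhds hb.symm)] with σ hσ using Ne.symm hσ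
    filter_upwards [hne s, hne r, nhdsWithin_le_nhds (Ioi_mem_nhds hτ)] with σ h1 h2 h3
    exact integral_weight_div_three_of_ne hs hr h3 hsr h1 h2
  exact tendsto_nhds_unique
    ((hcont.tendsto.mono_left nhdsWithin_le_nhds).congr' hev)
    (hcont'.tendsto.mono_left nhdsWithin_le_nhds)

end ArcsineIntegrals

/-! ### The measure μ_a: poles, mass of the atom, and the transform ∫ μ_a(dx)/(1 - tx). -/

namespace QFock

section VacuumMeasure

open Set

lemma sqrt_disc_sq {a : ℝ} (ha : 1 < a) : √((a + 3) * (a - 1)) ^ 2 = (a + 3) * (a - 1) :=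
  Real.sq_sqrt (mul_nonneg (by linarith) (by linarith))

lemma sqrt_disc_pos {a : ℝ} (ha : 1 < a) : 0 < √((a + 3) * (a - 1)) :=
  Real.sqrt_pos.2 (mul_pos (by linarith) (by linarith))

/-- The larger root of `σ ^ 2 - 2 a σ + 3 - 2 a`. -/
noncomputable def rootPlus (a : ℝ) : ℝ := a + √((a + 3) * (a - 1))

/-- The absolute value of the smaller root of `σ ^ 2 - 2 a σ + 3 - 2 a`. -/
noncomputable def rootMinus (a : ℝ) : ℝ := |a - √((a + 3) * (a - 1))|

lemma rootMinus_nonneg (a : ℝ) : 0 ≤ rootMinus a := abs_nonneg _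

lemma rootPlus_pos {a : ℝ} (ha : 1 < a) : 0 < rootPlus a :=
  add_pos (by linarith) (sqrt_disc_pos ha)

lemma rootMinus_ne_rootPlus {a : ℝ} (ha : 1 < a) : rootMinus a ≠ rootPlus a := by
  have := sqrt_disc_pos ha
  exact (abs_lt.2 ⟨by linarith, by linarith⟩ : _ < a + √((a + 3) * (a - 1))).ne

/-- The radicand is a²(a + 3)/(a - 1), because (a + 2)²(a - 1) + 4 = a²(a + 3). -/
lemma sqrt_location {a : ℝ} (ha : 1 < a) :
    √((a + 2) ^ 2 + 4 / (a - 1)) = a * √((a + 3) * (a - 1)) / (a - 1) := by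
  have h1 : 0 < a - 1 := by linarith
  have hd := sqrt_disc_pos ha
  rw [Real.sqrt_eq_iff_mul_self_eq (by positivity) (by positivity)]
  rw [← pow_two, div_pow, mul_pow, sqrt_disc_sq ha]
  field_simp
  ring

lemma a₁_mul {a : ℝ} (ha : 1 < a) : a₁ a * (1 - rootMinus a ^ 2) = 1 := by
  have h1 : a - 1 ≠ 0 := by linarith
  have hd := sqrt_disc_sq ha
  rw [a₁, sqrt_location ha, rootMinus, sq_abs]
  generalize √((a + 3) * (a - 1)) = d at hd ⊢
  field_simp
  linear_combination (a ^ 2 + 2 - d * a - a) * hd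

lemma a₂_mul {a : ℝ} (ha : 1 < a) : a₂ a * (rootPlus a ^ 2 - 1) = 1 := by
  have h1 : a - 1 ≠ 0 := by linarith
  have hd := sqrt_disc_sq ha
  rw [a₂, sqrt_location ha, rootPlus]
  generalize √((a + 3) * (a - 1)) = d at hd ⊢
  field_simp
  linear_combination (a ^ 2 + 2 + d * a - a) * hd

lemma a₁_pos {a : ℝ} (ha : 1 < a) : 0 < a₁ a := by
  rw [a₁]
  positivity

lemma a₁_add_a₂ {a : ℝ} (ha : 1 < a) :
    a₁ a + a₂ a = a * √((a + 3) * (a - 1)) / (4 * (a - 1)) := by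
  have h1 : a - 1 ≠ 0 := by linarith
  rw [a₁, a₂, sqrt_location ha]
  field_simp
  ring

/-- In this form the mass of the atom is visibly 0 when d ≤ a, that is a ≤ 3/2, and 1 - a/d
otherwise, where d = √((a + 3)(a - 1)). -/
lemma A₁_div {a : ℝ} (ha : 1 < a) :
    A₁ a / (16 * (a - 1)) =
      1 - (rootPlus a - rootMinus a) / (2 * √((a + 3) * (a - 1))) := by
  have h1 : a - 1 ≠ 0 := by linarith
  have ha0 : a ≠ 0 := by linarith
  have hd := (sqrt_disc_pos ha).ne'
  have e1 : (a₁ a - 1) / a₁ a = rootMinus a ^ 2 := by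
    have := a₁_mul ha
    rw [div_eq_iff (a₁_pos ha).ne']
    linarith
  have e2 : (a₂ a + 1) / a₂ a = rootPlus a ^ 2 := by
    have := a₂_mul ha
    rw [div_eq_iff (left_ne_zero_of_mul_eq_one this)]
    linarith
  rw [A₁, e1, e2, Real.sqrt_sq (rootPlus_pos ha).le, Real.sqrt_sq (rootMinus_nonneg a),
    a₁_add_a₂ ha]
  field_simp
  ring

lemma A₁_div_nonneg {a : ℝ} (ha : 1 < a) : 0 ≤ A₁ a / (16 * (a - 1)) := by
  have hd := sqrt_disc_pos ha
  rw [A₁_div ha, sub_nonneg, div_le_one (by positivity), rootPlus, rootMinus]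
  linarith [le_abs_self (a - √((a + 3) * (a - 1)))]

lemma density_eq {a : ℝ} (ha : 1 < a) {x : ℝ} (hx : x ∈ Ioo (0 : ℝ) 1) :
    a / (8 * Real.pi * (a - 1)) * (-g a x) = 2 * a / Real.pi * (marchenkoWeight x /
      ((1 - (1 - rootMinus a ^ 2) * x) * (1 - (1 - rootPlus a ^ 2) * x))) := by
  have h1 : a - 1 ≠ 0 := by linarith
  have hd := sqrt_disc_sq ha
  have hr : 1 - rootPlus a ^ 2 ≤ 1 := by nlinarith
  have hs : 1 - rootMinus a ^ 2 ≤ 1 := by nlinarith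
  have hx0 : √x ≠ 0 := (Real.sqrt_pos.2 hx.1).ne'
  have e : x ^ 2 - (a + 2) / 4 * x - 1 / (16 * (a - 1)) =
      -(((1 - (1 - rootMinus a ^ 2) * x) * (1 - (1 - rootPlus a ^ 2) * x)) / (16 * (a - 1))) := by
    rw [rootMinus, rootPlus, sq_abs]
    generalize √((a + 3) * (a - 1)) = d at hd ⊢
    field_simp
    have h4 : d ^ 4 = ((a + 3) * (a - 1)) ^ 2 := by rw [← hd]; ring
    ring_nf
    simp only [hd, h4]
    ring
  have p1 := (one_sub_mul_pos hs hx).ne'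
  have p2 := (one_sub_mul_pos hr hx).ne'
  rw [g, indicator_of_mem hx, e, marchenkoWeight]
  have := Real.pi_ne_zero
  generalize 1 - (1 - rootMinus a ^ 2) * x = y at *
  generalize 1 - (1 - rootPlus a ^ 2) * x = z at *
  field_simp
  ring

lemma density_nonneg {a : ℝ} (ha : 1 < a) (x : ℝ) :
    0 ≤ a / (8 * Real.pi * (a - 1)) * (-g a x) := by
  by_cases hx : x ∈ Ioo (0 : ℝ) 1
  · rw [density_eq ha hx]
    have := one_sub_mul_pos (p := 1 - rootMinus a ^ 2) (by nlinarith) hx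
    have := one_sub_mul_pos (p := 1 - rootPlus a ^ 2) (by nlinarith) hx
    have := Real.pi_pos
    unfold marchenkoWeight
    positivity
  · simp [g, hx]

lemma measurable_g (a : ℝ) : Measurable (g a) :=
  Measurable.indicator (by fun_prop) measurableSet_Ioo

lemma density_mul_eq_indicator {a : ℝ} (ha : 1 < a) (F : ℝ → ℝ) :
    (fun x => a / (8 * Real.pi * (a - 1)) * (-g a x) * F x) =
      (Ioo (0 : ℝ) 1).indicator (fun x => 2 * a / Real.pi * (marchenkoWeight x /
      ((1 - (1 - rootMinus a ^ 2) * x) * (1 - (1 - rootPlus a ^ 2) * x)) * F x)) := by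
  funext x
  by_cases hx : x ∈ Ioo (0 : ℝ) 1
  · rw [density_eq ha hx, indicator_of_mem hx, mul_assoc]
  · simp [g, hx]

/-- Only the density imposes a condition: a point mass integrates every real function. -/
lemma integrable_muMeasure {a : ℝ} (ha : 1 < a) {F : ℝ → ℝ}
    (hF : IntervalIntegrable (fun x => marchenkoWeight x /
      ((1 - (1 - rootMinus a ^ 2) * x) * (1 - (1 - rootPlus a ^ 2) * x)) * F x) volume 0 1) :
    Integrable F (muMeasure a) := by
  have hm : Measurable fun x => ENNReal.ofReal (a / (8 * Real.pi * (a - 1)) * (-g a x)) :=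
    ((measurable_g a).neg.const_mul _).ennreal_ofReal
  refine Integrable.add_measure ?_ ?_
  · rw [integrable_withDensity_iff_integrable_smul' hm
      (Filter.Eventually.of_forall fun x => ENNReal.ofReal_lt_top)]
    simp only [ENNReal.toReal_ofReal (density_nonneg ha _), smul_eq_mul]
    rw [density_mul_eq_indicator ha, integrable_indicator_iff measurableSet_Ioo]
    exact (intervalIntegrable_iff_integrableOn_Ioo_of_le zero_le_one).1 (hF.const_mul _)
  · exact (integrable_dirac (by simp)).smul_measure ENNReal.ofReal_ne_top

lemma integral_muMeasure {a : ℝ} (ha : 1 < a) {F : ℝ → ℝ}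
    (hF : IntervalIntegrable (fun x => marchenkoWeight x /
      ((1 - (1 - rootMinus a ^ 2) * x) * (1 - (1 - rootPlus a ^ 2) * x)) * F x) volume 0 1) :
    ∫ x, F x ∂(muMeasure a) = 2 * a / Real.pi * (∫ x in (0 : ℝ)..1, marchenkoWeight x /
      ((1 - (1 - rootMinus a ^ 2) * x) * (1 - (1 - rootPlus a ^ 2) * x)) * F x)
      + A₁ a / (16 * (a - 1)) * F (a₁ a) := by
  have hm : Measurable fun x => ENNReal.ofReal (a / (8 * Real.pi * (a - 1)) * (-g a x)) :=
    ((measurable_g a).neg.const_mul _).ennreal_ofReal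
  have hint := integrable_muMeasure ha hF
  rw [muMeasure] at hint ⊢
  rw [integral_add_measure (hint.mono_measure (Measure.le_add_right le_rfl))
    (hint.mono_measure (Measure.le_add_left le_rfl)),
    integral_withDensity_eq_integral_toReal_smul hm
      (Filter.Eventually.of_forall fun x => ENNReal.ofReal_lt_top), integral_smul_measure,
    integral_dirac, ENNReal.toReal_ofReal (A₁_div_nonneg ha)]
  simp only [ENNReal.toReal_ofReal (density_nonneg ha _), smul_eq_mul]
  rw [density_mul_eq_indicator ha, integral_indicator measurableSet_Ioo,
    ← integral_Ioc_eq_integral_Ioo, ← intervalIntegral.integral_of_le zero_le_one,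
    intervalIntegral.integral_const_mul]

/-- In terms of `τ = √(1 - t)`, the value `S a t` is a ratio of quadratic polynomials. -/
lemma S_eq (a t : ℝ) (ht : t < 1) :
    S a t = 2 * (2 - a + a * √(1 - t)) / (√(1 - t) ^ 2 + 2 * a * √(1 - t) + 3 - 2 * a) := by
  have h : √(1 - t) ^ 2 = 1 - t := Real.sq_sqrt (by linarith)
  rw [S, ← mul_div_mul_left _ _ (two_ne_zero (α := ℝ))]
  congr 1
  rw [h]
  ring

lemma stieltjes_identity {a τ : ℝ} (ha : 1 < a) (hτ : 0 < τ)
    (hne : 3 / 2 < a → 1 - τ ^ 2 ≠ 1 / a₁ a) :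
    2 * a * (1 + rootMinus a * rootPlus a + rootMinus a * τ + rootPlus a * τ)
        / ((rootMinus a + rootPlus a) * (rootMinus a + τ) * (rootPlus a + τ))
      + A₁ a / (16 * (a - 1)) * (1 / (1 - (1 - τ ^ 2) * a₁ a))
      = 2 * (2 - a + a * τ) / (τ ^ 2 + 2 * a * τ + 3 - 2 * a) := by
  have hd := sqrt_disc_pos ha
  have hd2 := sqrt_disc_sq ha
  have hs0 := rootMinus_nonneg a
  have hr0 := rootPlus_pos ha
  have hsτ : 0 < rootMinus a + τ := by linarith
  have hrτ : 0 < rootPlus a + τ := by linarith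
  have hsr : 0 < rootMinus a + rootPlus a := by linarith
  have ham := a₁_mul ha
  rw [A₁_div ha]
  rcases le_or_gt a (3 / 2) with hle | hgt
  · have hda : √((a + 3) * (a - 1)) ≤ a := by
      refine abs_le_of_sq_le_sq' ?_ (by linarith) |>.2
      nlinarith
    have hs : rootMinus a = a - √((a + 3) * (a - 1)) := abs_of_nonneg (sub_nonneg.2 hda)
    -- No atom here, so the value of its factor is irrelevant, even where the denominator vanishes.
    have hm : 1 - (rootPlus a - rootMinus a) / (2 * √((a + 3) * (a - 1))) = 0 := by
      rw [hs, rootPlus]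
      field_simp
      ring
    have hden : τ ^ 2 + 2 * a * τ + 3 - 2 * a = (rootMinus a + τ) * (rootPlus a + τ) := by
      rw [hs, rootPlus]
      linear_combination hd2
    have hsum : rootMinus a + rootPlus a = 2 * a := by rw [hs, rootPlus]; ring
    have hprod : rootMinus a * rootPlus a = 3 - 2 * a := by
      rw [hs, rootPlus]; linear_combination -hd2
    rw [hm, zero_mul, add_zero, hden, hprod,
      show 1 + (3 - 2 * a) + rootMinus a * τ + rootPlus a * τ = 2 * (2 - a + a * τ) by
        linear_combination τ * hsum, hsum]
    have ha0 : a ≠ 0 := by linarith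
    field_simp
  · have hda : a ≤ √((a + 3) * (a - 1)) := by
      refine abs_le_of_sq_le_sq' ?_ hd.le |>.2
      nlinarith
    have hs : rootMinus a = √((a + 3) * (a - 1)) - a := by
      rw [rootMinus, abs_sub_comm]
      exact abs_of_nonneg (sub_nonneg.2 hda)
    have hpos : 0 < a₁ a := a₁_pos ha
    have h1 : 1 - (1 - τ ^ 2) * a₁ a = (τ - rootMinus a) * (τ + rootMinus a) * a₁ a := by
      linear_combination -ham
    -- This is where the excluded point enters: τ = s means t = 1 - s² = 1/a₁.
    have h2 : τ - rootMinus a ≠ 0 := by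
      intro h
      refine hne hgt ?_
      rw [eq_div_iff hpos.ne', sub_eq_zero.1 h, mul_comm]
      exact ham
    have h3 : 1 / (1 - (1 - τ ^ 2) * a₁ a) =
        (1 - rootMinus a ^ 2) / ((τ - rootMinus a) * (τ + rootMinus a)) := by
      rw [h1, div_eq_div_iff (mul_ne_zero (mul_ne_zero h2 (by linarith)) hpos.ne')
        (mul_ne_zero h2 (by linarith))]
      linear_combination -(τ - rootMinus a) * (τ + rootMinus a) * ham
    have hden : τ ^ 2 + 2 * a * τ + 3 - 2 * a = (τ - rootMinus a) * (rootPlus a + τ) := by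
      rw [hs, rootPlus]
      linear_combination hd2
    have h4 : τ + rootMinus a ≠ 0 := by linarith
    rw [h3, hden]
    rw [hs] at h2 h4 hsτ hsr ⊢
    rw [rootPlus] at hrτ hsr ⊢
    generalize √((a + 3) * (a - 1)) = d at *
    have ea : d - a + (a + d) = 2 * d := by ring
    have eb : a + d - (d - a) = 2 * a := by ring
    rw [ea, eb]
    have := hsτ.ne'
    have := hrτ.ne'
    rw [add_comm τ (d - a)]
    generalize hu : d - a + τ = u at *
    generalize hv : τ - (d - a) = v at *
    generalize hw : a + d + τ = w at *
    field_simp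
    subst hu hv hw
    linear_combination (-d ^ 2 + (a - τ) * d) * hd2

theorem integral_one_div_muMeasure {a t : ℝ} (ha : 1 < a) (ht : t < 1)
    (hne : 3 / 2 < a → t ≠ 1 / a₁ a) :
    Integrable (fun x : ℝ => 1 / (1 - t * x)) (muMeasure a) ∧
      ∫ x, 1 / (1 - t * x) ∂(muMeasure a) = S a t := by
  have hτ : 0 < √(1 - t) := Real.sqrt_pos.2 (by linarith)
  have htτ : t = 1 - √(1 - t) ^ 2 := by rw [Real.sq_sqrt (by linarith)]; ring
  have hr := rootPlus_pos ha
  have hF := intervalIntegrable_weight_div_three (p := 1 - rootMinus a ^ 2)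
    (r := 1 - rootPlus a ^ 2) (t := t) (by nlinarith) (by nlinarith) ht
  refine ⟨integrable_muMeasure ha hF, ?_⟩
  rw [integral_muMeasure ha hF, S_eq a t ht]
  generalize √(1 - t) = τ at *
  subst htτ
  rw [integral_weight_div_three (rootMinus_nonneg a) hr hτ (rootMinus_ne_rootPlus ha),
    ← stieltjes_identity ha hτ hne]
  congr 1
  have := Real.pi_ne_zero
  field_simp

end VacuumMeasure

end QFock

/-! ### Action of creation, annihilation and Q(f)² on the vectors A⁺(f)ⁿΦ. -/

namespace QFock

lemma isSelfAdjoint_adjoint_add_self {K : Type*} [NormedAddCommGroup K] [InnerProductSpace ℂ K]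
    [CompleteSpace K] (T : K →L[ℂ] K) : IsSelfAdjoint (ContinuousLinearMap.adjoint T + T) :=
  IsSelfAdjoint.star_add_self T

section FockPowers

variable {H : Type*} [NormedAddCommGroup H] [InnerProductSpace ℂ H] (q : Set.Icc (-1 : ℝ) 1)

/-- The tensor power `f ⊗ ⋯ ⊗ f` with `n + 1` factors. -/
noncomputable def tensorPower (f : H) : (n : ℕ) → TPow H n
  | 0 => f
  | n + 1 => tmulLeft H f n (tensorPower f n)

/-- The tensor power `f ⊗ ⋯ ⊗ f` with `n + 1` factors in the `(n + 1)`-particle space. -/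
noncomputable def particlePower (f : H) (n : ℕ) : Particle H q n :=
  ((toPre H q n (tensorPower f n) : PrePart H q n) : Particle H q n)

/-- The inclusion of the `(n + 1)`-particle space in the Fock space. -/
noncomputable def ofParticle (n : ℕ) (x : Particle H q n) : Fock H q :=
  WithLp.toLp 2 (0, lp.single 2 n x)

lemma inner_ofParticle (n : ℕ) (x : Particle H q n) (y : Fock H q) :
    inner ℂ (ofParticle q n x) y = inner ℂ x (y.snd n) := by
  rw [WithLp.prod_inner_apply]
  change inner ℂ (0 : ℂ) _ + inner ℂ (lp.single 2 n x) y.snd = _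
  rw [inner_zero_left, zero_add]
  exact lp.inner_single_left n x y.snd

lemma inner_vacuum (y : Fock H q) : inner ℂ (vacuum H q) y = y.fst := by
  rw [WithLp.prod_inner_apply]
  change inner ℂ (1 : ℂ) y.fst + inner ℂ 0 y.snd = _
  rw [inner_zero_left, add_zero]
  simp

lemma create_snd_succ (f : H) (y : Fock H q) (n : ℕ) :
    (create q f y).snd (n + 1) = createPart q f n (y.snd n) := rfl

lemma create_snd_zero (f : H) (y : Fock H q) :
    (create q f y).snd 0 = y.fst • onePart q f := rfl

lemma create_fst (f : H) (y : Fock H q) : (create q f y).fst = 0 := rfl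

lemma create_vacuum (f : H) :
    create q f (vacuum H q) = ofParticle q 0 (particlePower q f 0) := by
  apply (WithLp.equiv 2 _).injective
  refine Prod.ext rfl (lp.ext (funext fun n => ?_))
  change (create q f (vacuum H q)).snd n = lp.single 2 0 (particlePower q f 0) n
  cases n with
  | zero =>
    rw [create_snd_zero, lp.single_apply_self]
    exact one_smul ℂ _
  | succ n =>
    rw [create_snd_succ, lp.single_apply_ne _ _ _ (Nat.succ_ne_zero n)]
    exact map_zero _

lemma create_ofParticle (f : H) (n : ℕ) (x : Particle H q n) :
    create q f (ofParticle q n x) = ofParticle q (n + 1) (createPart q f n x) := by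
  apply (WithLp.equiv 2 _).injective
  refine Prod.ext rfl (lp.ext (funext fun m => ?_))
  change (create q f (ofParticle q n x)).snd m = lp.single 2 (n + 1) (createPart q f n x) m
  cases m with
  | zero =>
    rw [create_snd_zero, lp.single_apply_ne _ _ _ (Nat.succ_ne_zero n).symm]
    exact zero_smul ℂ _
  | succ m =>
    rw [create_snd_succ]
    change createPart q f m (lp.single 2 n x m) = _
    rcases eq_or_ne m n with rfl | hmn
    · rw [lp.single_apply_self, lp.single_apply_self]
    · rw [lp.single_apply_ne _ _ _ hmn, lp.single_apply_ne _ _ _ (by simpa using hmn), map_zero]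

lemma createPart_particlePower (f : H) (n : ℕ) :
    createPart q f n (particlePower q f n) = particlePower q f (n + 1) :=
  ContinuousLinearMap.completion_apply_coe _ _

lemma inner_self_eq_ofReal_norm_sq (f : H) : inner ℂ f f = ((‖f‖ ^ 2 : ℝ) : ℂ) := by
  rw [inner_self_eq_norm_sq_to_K]
  norm_cast

/-- Pairing with f ⊗ f does not distinguish f ⊗ g from g ⊗ f, so λ₂ contributes the factor 1 + q.
This is the only place where q enters the matrix of Q(f). -/
lemma inner_particlePower_createPart_zero (f : H) (x : Particle H q 0) :
    inner ℂ (particlePower q f 1) (createPart q f 0 x)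
      = ((‖f‖ ^ 2 * (1 + q) : ℝ) : ℂ) * inner ℂ (particlePower q f 0) x := by
  induction x using UniformSpace.Completion.induction_on with
  | hp => exact isClosed_eq (by fun_prop) (by fun_prop)
  | ih y =>
    rw [createPart, ContinuousLinearMap.completion_apply_coe, particlePower, particlePower,
      UniformSpace.Completion.inner_coe, UniformSpace.Completion.inner_coe]
    have key (g : H) : inner ℂ (E := H ⊗[ℂ] H) (f ⊗ₜ[ℂ] f)
        (f ⊗ₜ[ℂ] g + ((q : ℝ) : ℂ) • (g ⊗ₜ[ℂ] f))
        = ((‖f‖ ^ 2 * (1 + q) : ℝ) : ℂ) * inner ℂ f g := by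
      rw [inner_add_right, TensorProduct.smul_tmul', TensorProduct.inner_tmul,
        TensorProduct.inner_tmul, inner_smul_right, inner_self_eq_ofReal_norm_sq]
      push_cast
      ring
    exact key y

/-- From three tensor factors on, λ is the identity on the leftmost one, so that factor splits off
as ⟨f, f⟩. -/
lemma inner_particlePower_createPart_succ (f : H) (n : ℕ) (x : Particle H q (n + 1)) :
    inner ℂ (particlePower q f (n + 2)) (createPart q f (n + 1) x)
      = ((‖f‖ ^ 2 : ℝ) : ℂ) * inner ℂ (particlePower q f (n + 1)) x := by
  induction x using UniformSpace.Completion.induction_on with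
  | hp => exact isClosed_eq (by fun_prop) (by fun_prop)
  | ih y =>
    rw [createPart, ContinuousLinearMap.completion_apply_coe, particlePower, particlePower,
      UniformSpace.Completion.inner_coe, UniformSpace.Completion.inner_coe,
      ← inner_self_eq_ofReal_norm_sq]
    rfl

/-- The vectors `A⁺(f)ⁿ Φ`. -/
noncomputable def fockPower (f : H) (n : ℕ) : Fock H q := (create q f ^ n) (vacuum H q)

lemma fockPower_zero (f : H) : fockPower q f 0 = vacuum H q := rfl

lemma create_fockPower (f : H) (n : ℕ) :
    create q f (fockPower q f n) = fockPower q f (n + 1) := by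
  rw [fockPower, fockPower, pow_succ', mul_apply_eq_comp]

lemma fockPower_succ (f : H) (n : ℕ) :
    fockPower q f (n + 1) = ofParticle q n (particlePower q f n) := by
  induction n with
  | zero => rw [← create_fockPower, fockPower_zero, create_vacuum]
  | succ n ih => rw [← create_fockPower, ih, create_ofParticle, createPart_particlePower]

lemma annihilate_eq {f : H} {x z : Fock H q}
    (h : ∀ y, inner ℂ x (create q f y) = inner ℂ z y) : annihilate q f x = z :=
  ext_inner_right ℂ fun y => by rw [annihilate, ContinuousLinearMap.adjoint_inner_left, h]

lemma annihilate_vacuum (f : H) : annihilate q f (fockPower q f 0) = 0 :=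
  annihilate_eq q fun y => by rw [fockPower_zero, inner_vacuum, create_fst, inner_zero_left]

lemma annihilate_fockPower_one (f : H) :
    annihilate q f (fockPower q f 1) = ((‖f‖ ^ 2 : ℝ) : ℂ) • fockPower q f 0 := by
  refine annihilate_eq q fun y => ?_
  rw [fockPower_succ, inner_ofParticle, create_snd_zero, inner_smul_right, inner_smul_left,
    fockPower_zero, inner_vacuum, Complex.conj_ofReal, mul_comm]
  congr 1
  rw [particlePower, onePart, UniformSpace.Completion.inner_coe, ← inner_self_eq_ofReal_norm_sq]
  rfl

lemma annihilate_fockPower_two (f : H) :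
    annihilate q f (fockPower q f 2)
      = ((‖f‖ ^ 2 * (1 + q) : ℝ) : ℂ) • fockPower q f 1 := by
  refine annihilate_eq q fun y => ?_
  rw [fockPower_succ, fockPower_succ, inner_ofParticle, create_snd_succ, inner_smul_left,
    inner_particlePower_createPart_zero, inner_ofParticle, Complex.conj_ofReal]

lemma annihilate_fockPower_add_three (f : H) (n : ℕ) :
    annihilate q f (fockPower q f (n + 3)) = ((‖f‖ ^ 2 : ℝ) : ℂ) • fockPower q f (n + 2) := by
  refine annihilate_eq q fun y => ?_
  rw [fockPower_succ, fockPower_succ, inner_ofParticle, create_snd_succ, inner_smul_left,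
    inner_particlePower_createPart_succ, inner_ofParticle, Complex.conj_ofReal]

lemma inner_vacuum_fockPower_succ (f : H) (n : ℕ) :
    inner ℂ (vacuum H q) (fockPower q f (n + 1)) = 0 := by
  rw [inner_vacuum, ← create_fockPower, create_fst]

lemma inner_vacuum_vacuum : inner ℂ (vacuum H q) (vacuum H q) = 1 := by
  rw [inner_vacuum]; rfl

lemma norm_create_le (f : H) : ‖create q f‖ ≤ 2 * ‖f‖ :=
  LinearMap.mkContinuous_norm_le _ (by positivity) _

lemma norm_vacuum : ‖vacuum H q‖ = 1 := by
  have h := inner_self_eq_ofReal_norm_sq (vacuum H q)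
  rw [inner_vacuum_vacuum] at h
  have : ‖vacuum H q‖ ^ 2 = 1 := by exact_mod_cast h.symm
  exact (pow_eq_one_iff_of_nonneg (norm_nonneg _) two_ne_zero).1 this

lemma norm_fockPower_le (f : H) (n : ℕ) : ‖fockPower q f n‖ ≤ (2 * ‖f‖) ^ n := by
  induction n with
  | zero => rw [fockPower_zero, norm_vacuum, pow_zero]
  | succ n ih =>
    rw [← create_fockPower, pow_succ']
    exact (ContinuousLinearMap.le_opNorm _ _).trans
      (mul_le_mul (norm_create_le q f) ih (norm_nonneg _) (by positivity))

lemma isSelfAdjoint_field (f : H) : IsSelfAdjoint (field q f) :=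
  isSelfAdjoint_adjoint_add_self (create q f)

lemma field_sq_fockPower_zero {f : H} (hf : ‖f‖ = 1 / 2) :
    (field q f ^ 2) (fockPower q f 0)
      = fockPower q f 2 + (1 / 4 : ℂ) • fockPower q f 0 := by
  rw [pow_two, mul_apply_eq_comp]
  simp only [field, add_apply, create_fockPower, annihilate_vacuum, zero_add,
    annihilate_fockPower_one, hf]
  rw [add_comm]
  norm_num

lemma field_sq_fockPower_two {f : H} (hf : ‖f‖ = 1 / 2) :
    (field q f ^ 2) (fockPower q f 2)
      = fockPower q f 4 + ((2 + (q : ℝ)) / 4 : ℂ) • fockPower q f 2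
        + ((1 + (q : ℝ)) / 16 : ℂ) • fockPower q f 0 := by
  rw [pow_two, mul_apply_eq_comp]
  simp only [field, add_apply, create_fockPower, map_add, map_smul,
    annihilate_fockPower_two, annihilate_fockPower_one, annihilate_fockPower_add_three, hf]
  push_cast
  module

lemma field_sq_fockPower_add_four {f : H} (hf : ‖f‖ = 1 / 2) (n : ℕ) :
    (field q f ^ 2) (fockPower q f (n + 4))
      = fockPower q f (n + 6) + (1 / 2 : ℂ) • fockPower q f (n + 4)
        + (1 / 16 : ℂ) • fockPower q f (n + 2) := by
  have h : annihilate q f (fockPower q f (n + 4)) = _ := annihilate_fockPower_add_three q f (n + 1)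
  have h' : annihilate q f (fockPower q f (n + 5)) = _ := annihilate_fockPower_add_three q f (n + 2)
  rw [pow_two, mul_apply_eq_comp]
  simp only [field, add_apply, create_fockPower, map_add, map_smul, h, h',
    annihilate_fockPower_add_three, hf]
  push_cast
  module

end FockPowers

end QFock

/-! ### Neumann series, uniqueness of power series, and moments of bounded measures. -/

lemma hasSum_inner_pow_of_resolvent {K : Type*} [NormedAddCommGroup K] [InnerProductSpace ℂ K]
    [CompleteSpace K] (T : K →L[ℂ] K) {Φ V : K} {t κ : ℂ} (h : V - t • T V = κ • Φ)
    (ht : ‖t • T‖ < 1) :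
    HasSum (fun n => κ * (t ^ n * inner ℂ Φ ((T ^ n) Φ))) (inner ℂ Φ V) := by
  have hs := (summable_geometric_of_norm_lt_one ht).hasSum
  have hV : (∑' n, (t • T) ^ n) (κ • Φ) = V := by
    have h1 := congrArg (fun A : K →L[ℂ] K => A V) (geom_series_mul_neg (t • T) ht)
    rw [← h]
    exact h1
  have h2 := (hs.mapL (ContinuousLinearMap.apply ℂ K (κ • Φ))).mapL (innerSL ℂ Φ)
  have h3 : innerSL ℂ Φ (ContinuousLinearMap.apply ℂ K (κ • Φ) (∑' n, (t • T) ^ n))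
      = inner ℂ Φ V := by
    rw [← hV]
    rfl
  rw [h3] at h2
  refine h2.congr_fun fun n => ?_
  change _ = inner ℂ Φ (((t • T) ^ n) (κ • Φ))
  rw [smul_pow, map_smul, inner_smul_right]
  change _ = κ * inner ℂ Φ (t ^ n • (T ^ n) Φ)
  rw [inner_smul_right]

lemma eventually_norm_ofReal_smul_lt_one {K : Type*} [NormedAddCommGroup K]
    [InnerProductSpace ℂ K] (T : K →L[ℂ] K) : ∀ᶠ t : ℝ in nhds 0, ‖(t : ℂ) • T‖ < 1 := by
  have h : Continuous fun t : ℝ => ‖(t : ℂ) • T‖ := by fun_prop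
  exact (h.tendsto' 0 0 (by simp)).eventually_lt_const one_pos

lemma eq_of_hasSum_pow_smul_eventually {E : Type*} [NormedAddCommGroup E] [NormedSpace ℝ E]
    {c d : ℕ → E} {F : ℝ → E} (hc : ∀ᶠ t in nhds (0 : ℝ), HasSum (fun n => t ^ n • c n) (F t))
    (hd : ∀ᶠ t in nhds (0 : ℝ), HasSum (fun n => t ^ n • d n) (F t)) : c = d := by
  have key (e : ℕ → E) (he : ∀ᶠ t in nhds (0 : ℝ), HasSum (fun n => t ^ n • e n) (F t)) :
      HasFPowerSeriesAt F (show FormalMultilinearSeries ℝ ℝ E from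
        fun n => ContinuousMultilinearMap.mkPiRing ℝ (Fin n) (e n)) 0 := by
    refine hasFPowerSeriesAt_iff.2 ?_
    simpa [FormalMultilinearSeries.coeff] using he
  have h := (key c hc).eq_formalMultilinearSeries (key d hd)
  funext n
  have hn := congrArg (fun p : FormalMultilinearSeries ℝ ℝ E => p.coeff n) h
  simpa [FormalMultilinearSeries.coeff] using hn

lemma hasSum_moments_integral {μ : Measure ℝ} [IsFiniteMeasure μ] {M : ℝ}
    (hM : ∀ᵐ x ∂μ, |x| ≤ M) {t : ℝ} (ht : |t| * M < 1) :
    HasSum (fun n => t ^ n * ∫ x, x ^ n ∂μ) (∫ x, 1 / (1 - t * x) ∂μ) := by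
  have hb : ∀ᵐ x ∂μ, |t * x| ≤ |t| * M := by
    filter_upwards [hM] with x hx
    rw [abs_mul]
    gcongr
  -- For the zero measure the bound M may be negative, and the geometric domination fails.
  rcases eq_or_ne μ 0 with rfl | hμ
  · simp
  have : NeZero μ := ⟨hμ⟩
  have hM0 : 0 ≤ |t| * M := by
    obtain ⟨x, hx⟩ := hb.exists
    exact (abs_nonneg _).trans hx
  have hsum := summable_geometric_of_lt_one hM0 ht
  have h := hasSum_integral_of_dominated_convergence (μ := μ)
    (F := fun n x => (t * x) ^ n) (f := fun x => 1 / (1 - t * x))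
    (fun n _ => (|t| * M) ^ n) (fun n => by fun_prop) (fun n => ?_)
    (Filter.Eventually.of_forall fun _ => hsum) (integrable_const _) ?_
  · refine h.congr_fun fun n => ?_
    rw [← integral_const_mul]
    simp only [mul_pow]
  · filter_upwards [hb] with x hx
    rw [norm_pow, Real.norm_eq_abs]
    gcongr
  · filter_upwards [hb] with x hx
    rw [one_div]
    exact hasSum_geometric_of_abs_lt_one (hx.trans_lt ht)

/-! ### The explicit resolvent vector and equality of moments. -/

namespace QFock

section Moments

variable {H : Type*} [NormedAddCommGroup H] [InnerProductSpace ℂ H] (q : Set.Icc (-1 : ℝ) 1)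

lemma summable_fockPower {f : H} (hf : ‖f‖ = 1 / 2) {z : ℂ} (hz : ‖z‖ < 1) (k : ℕ) :
    Summable fun n => z ^ n • fockPower q f (2 * n + k) := by
  refine Summable.of_norm_bounded (summable_geometric_of_lt_one (norm_nonneg z) hz) fun n => ?_
  rw [norm_smul, norm_pow]
  refine mul_le_of_le_one_right (by positivity) ((norm_fockPower_le q f _).trans ?_)
  rw [hf]
  norm_num

/-- The series `∑ zⁿ f^{⊗(2n+k)}`. -/
noncomputable def fockSeries (f : H) (z : ℂ) (k : ℕ) : Fock H q :=
  ∑' n, z ^ n • fockPower q f (2 * n + k)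

lemma fockSeries_eq {f : H} (hf : ‖f‖ = 1 / 2) {z : ℂ} (hz : ‖z‖ < 1) (k : ℕ) :
    fockSeries q f z k = fockPower q f k + z • fockSeries q f z (k + 2) := by
  rw [fockSeries, (summable_fockPower q hf hz k).tsum_eq_zero_add, fockSeries,
    ← (summable_fockPower q hf hz (k + 2)).tsum_const_smul]
  congr 1
  · simp
  · refine tsum_congr fun n => ?_
    rw [smul_smul, pow_succ', show 2 * (n + 1) + k = 2 * n + (k + 2) by ring]

lemma field_sq_fockSeries {f : H} (hf : ‖f‖ = 1 / 2) {z : ℂ} (hz : ‖z‖ < 1) :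
    (field q f ^ 2) (fockSeries q f z 4) = fockSeries q f z 6
      + (1 / 2 : ℂ) • fockSeries q f z 4 + (1 / 16 : ℂ) • fockSeries q f z 2 := by
  have h := (summable_fockPower q hf hz 4).hasSum.mapL (field q f ^ 2)
  have h6 := (summable_fockPower q hf hz 6).hasSum
  have h4 := (summable_fockPower q hf hz 4).hasSum.const_smul (1 / 2 : ℂ)
  have h2 := (summable_fockPower q hf hz 2).hasSum.const_smul (1 / 16 : ℂ)
  refine h.unique (((h6.add h4).add h2).congr_fun fun n => ?_)
  rw [map_smul, field_sq_fockPower_add_four q hf]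
  module

lemma inner_vacuum_fockSeries {f : H} (hf : ‖f‖ = 1 / 2) {z : ℂ} (hz : ‖z‖ < 1) :
    inner ℂ (vacuum H q) (fockSeries q f z 2) = 0 := by
  have h := (summable_fockPower q hf hz 2).hasSum.mapL (innerSL ℂ (vacuum H q))
  refine h.unique (hasSum_zero.congr_fun fun n => ?_)
  rw [map_smul, innerSL_apply_apply, inner_vacuum_fockPower_succ, smul_zero]

/-- `resolventVector` is a multiple of `(1 - t Q(f)²)⁻¹ Φ` for `t = 4 w / (1 + w)²`. -/
noncomputable def resolventVector (f : H) (w : ℂ) : Fock H q :=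
  (1 - (q : ℝ) * w) • fockPower q f 0 + (4 * w) • fockSeries q f (4 * w) 2

/-- With vₙ = (4w)ⁿ, vₙ₋₁ + vₙ/2 + vₙ₊₁/16 = vₙ(1 + w)²/(4w), so multiplication by t restores vₙ.
The term -qw at e₀ offsets the extra q/4 in the e₂ diagonal entry, and only a defect along Φ
remains. -/
lemma resolventVector_eq {f : H} (hf : ‖f‖ = 1 / 2) {w : ℂ} (hw : ‖4 * w‖ < 1)
    (hw1 : 1 + w ≠ 0) :
    resolventVector q f w - (4 * w / (1 + w) ^ 2) • (field q f ^ 2) (resolventVector q f w)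
      = (1 - (q : ℝ) * w - w / (1 + w)) • vacuum H q := by
  have hW2 : fockSeries q f (4 * w) 2 = fockPower q f 2 + (4 * w) • fockSeries q f (4 * w) 4 :=
    fockSeries_eq q hf hw 2
  have hW4 : fockSeries q f (4 * w) 4 = fockPower q f 4 + (4 * w) • fockSeries q f (4 * w) 6 :=
    fockSeries_eq q hf hw 4
  have h1 : (1 - (q : ℝ) * w - w / (1 + w) : ℂ)
      = ((1 + w) ^ 2)⁻¹ * ((1 + w) ^ 2 * (1 - (q : ℝ) * w) - w * (1 + w)) := by
    field_simp
  have h2 : (resolventVector q f w : Fock H q)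
      = ((1 + w) ^ 2)⁻¹ • ((1 + w) ^ 2 • resolventVector q f w) := by
    rw [smul_smul, inv_mul_cancel₀ (pow_ne_zero 2 hw1), one_smul]
  have h3 : (field q f ^ 2) (resolventVector q f w)
      = (1 - (q : ℝ) * w) • (fockPower q f 2 + (1 / 4 : ℂ) • fockPower q f 0)
        + (4 * w) • ((fockPower q f 4 + ((2 + (q : ℝ)) / 4 : ℂ) • fockPower q f 2
        + ((1 + (q : ℝ)) / 16 : ℂ) • fockPower q f 0)
        + (4 * w) • (fockSeries q f (4 * w) 6
      + (1 / 2 : ℂ) • fockSeries q f (4 * w) 4 + (1 / 16 : ℂ) • fockSeries q f (4 * w) 2)) := by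
    rw [resolventVector, hW2, map_add, map_smul, map_smul, map_add, map_smul,
      field_sq_fockPower_zero q hf, field_sq_fockPower_two q hf, field_sq_fockSeries q hf hw,
      hW2]
  -- Extracting (1 + w)⁻² leaves polynomial coefficients, to be compared on e₀, e₂, e₄ and the tail
  -- series.
  conv_lhs => enter [1]; rw [h2]
  rw [h1, div_eq_inv_mul, mul_smul ((1 + w) ^ 2)⁻¹ (4 * w),
    mul_smul ((1 + w) ^ 2)⁻¹ ((1 + w) ^ 2 * _ - _), ← smul_sub, h3, resolventVector,
    hW2, hW4, fockPower_zero]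
  congr 1
  generalize fockSeries q f (4 * w) 6 = W
  module

lemma inner_vacuum_resolventVector {f : H} (hf : ‖f‖ = 1 / 2) {w : ℂ} (hw : ‖4 * w‖ < 1) :
    inner ℂ (vacuum H q) (resolventVector q f w) = 1 - (q : ℝ) * w := by
  rw [resolventVector, inner_add_right, inner_smul_right, inner_smul_right,
    inner_vacuum_fockSeries q hf hw, fockPower_zero, inner_vacuum_vacuum]
  ring

lemma hasSum_vacuum_moments {f : H} (hf : ‖f‖ = 1 / 2) :
    ∀ᶠ t in nhds (0 : ℝ), HasSum (fun n => t ^ n • inner ℂ (vacuum H q)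
      (((field q f ^ 2) ^ n) (vacuum H q))) ((S (1 + q) t : ℝ) : ℂ) := by
  have hcont : ContinuousAt (fun t : ℝ => 4 * ((1 - √(1 - t)) / (1 + √(1 - t)))) 0 :=
    continuousAt_const.mul
      (ContinuousAt.div (by fun_prop) (by fun_prop) (by positivity))
  have hsmall : ∀ᶠ t in nhds (0 : ℝ), |4 * ((1 - √(1 - t)) / (1 + √(1 - t)))| < 1 :=
    hcont.abs.tendsto.eventually_lt_const (by simp)
  have hsmall' : ∀ᶠ t : ℝ in nhds 0, ‖(t : ℂ) • field q f ^ 2‖ < 1 :=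
    eventually_norm_ofReal_smul_lt_one _
  filter_upwards [hsmall, hsmall', Iio_mem_nhds zero_lt_one] with t h1 h2 ht
  have hτ0 : 0 < √(1 - t) := Real.sqrt_pos.2 (sub_pos.2 ht)
  have hτ2 : √(1 - t) ^ 2 = 1 - t := Real.sq_sqrt (sub_pos.2 ht).le
  set τ := √(1 - t) with hτ
  set w : ℝ := (1 - τ) / (1 + τ) with hw
  have hw1 : 0 < 1 + w := by
    rw [hw]
    have : 1 + (1 - τ) / (1 + τ) = 2 / (1 + τ) := by field_simp; ring
    rw [this]
    positivity
  have htw : t = 4 * w / (1 + w) ^ 2 := by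
    have : t = 1 - τ ^ 2 := by linarith
    rw [this, hw]
    field_simp
    ring
  have hτw : τ = (1 - w) / (1 + w) := by
    rw [hw]
    field_simp
    ring
  have hzw : ‖(4 * (w : ℂ))‖ < 1 := by
    rw [show (4 * (w : ℂ)) = ((4 * w : ℝ) : ℂ) by push_cast; ring, Complex.norm_real]
    exact h1
  have hw1' : (1 + w : ℂ) ≠ 0 := by exact_mod_cast hw1.ne'
  have htc : (t : ℂ) = 4 * w / (1 + w) ^ 2 := by
    rw [htw]
    push_cast
    ring
  have hres := resolventVector_eq q hf hzw hw1'
  rw [← htc] at hres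
  have hsum := hasSum_inner_pow_of_resolvent (field q f ^ 2) hres h2
  rw [inner_vacuum_resolventVector q hf hzw] at hsum
  set κ : ℝ := 1 - q * w - w / (1 + w) with hκ
  have hκc : (1 - (q : ℝ) * w - w / (1 + w) : ℂ) = (κ : ℂ) := by
    rw [hκ]
    push_cast
    ring
  rw [hκc] at hsum
  have hqw : 0 < 1 - q * w := by
    have hq := q.2
    have h4 := abs_lt.1 h1
    nlinarith [hq.1, hq.2]
  -- If κ vanished, every term of the Neumann expansion would be 0, yet its sum is 1 - qw > 0.
  have hκ0 : κ ≠ 0 := by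
    intro h0
    rw [h0] at hsum
    simp only [Complex.ofReal_zero, zero_mul] at hsum
    have := hasSum_zero.unique hsum
    exact hqw.ne (by exact_mod_cast this)
  have hS : S (1 + q) t = (1 - q * w) / κ := by
    have hnum : 2 - (1 + (q : ℝ)) + (1 + q) * τ = 2 / (1 + w) * (1 - q * w) := by
      rw [hτw]
      field_simp
      ring
    have hden : 2 - (1 + (q : ℝ)) + (1 + q) * τ - t / 2 = 2 / (1 + w) * κ := by
      rw [hnum, htw, hκ]
      field_simp
      ring
    rw [S, ← hτ, hden, hnum, mul_div_mul_left _ _ (by positivity)]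
  have h5 := hsum.mul_left (κ : ℂ)⁻¹
  rw [hS]
  have hκ0' : (κ : ℂ) ≠ 0 := by exact_mod_cast hκ0
  have hval : (((1 - q * w) / κ : ℝ) : ℂ) = (κ : ℂ)⁻¹ * (1 - (q : ℝ) * w) := by
    push_cast
    rw [div_eq_inv_mul]
  rw [hval]
  refine h5.congr_fun fun n => ?_
  rw [inv_mul_cancel_left₀ hκ0', Complex.real_smul, Complex.ofReal_pow]

end Moments

lemma isFiniteMeasure_muMeasure {a : ℝ} (ha : 1 < a) : IsFiniteMeasure (muMeasure a) := by
  -- At t = 0 the integrand is the constant 1, whose integrability means finite mass; likewise `S a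
  -- 0 = 1` gives total mass one below.
  have h := (integral_one_div_muMeasure (t := 0) ha zero_lt_one
    fun _ => (one_div_pos.2 (a₁_pos ha)).ne).1
  simpa [integrable_const_iff] using h

lemma isProbabilityMeasure_muMeasure {a : ℝ} (ha : 1 < a) :
    IsProbabilityMeasure (muMeasure a) := by
  have h := (integral_one_div_muMeasure (t := 0) ha zero_lt_one
    fun _ => (one_div_pos.2 (a₁_pos ha)).ne).2
  rw [isProbabilityMeasure_iff_real]
  simpa [S] using h

lemma muMeasure_compl_Icc (a : ℝ) : muMeasure a (Set.Icc (min 0 (a₁ a)) (max 1 (a₁ a)))ᶜ = 0 := by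
  have hm : MeasurableSet (Set.Icc (min 0 (a₁ a)) (max 1 (a₁ a)))ᶜ := measurableSet_Icc.compl
  rw [muMeasure, Measure.add_apply, Measure.smul_apply, withDensity_apply _ hm,
    Measure.dirac_apply' _ hm]
  have h : ∀ x ∈ (Set.Icc (min 0 (a₁ a)) (max 1 (a₁ a)))ᶜ,
      ENNReal.ofReal (a / (8 * Real.pi * (a - 1)) * (-g a x)) = 0 := by
    intro x hx
    have : x ∉ Set.Ioo (0 : ℝ) 1 := fun h => hx
      ⟨(min_le_left _ _).trans h.1.le, h.2.le.trans (le_max_left _ _)⟩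
    simp [g, this]
  rw [setLIntegral_congr_fun hm h]
  simp

lemma integral_pow_muMeasure {H : Type*} [NormedAddCommGroup H] [InnerProductSpace ℂ H]
    (q : Set.Icc (-1 : ℝ) 1) (hq : 0 < (q : ℝ)) {f : H} (hf : ‖f‖ = 1 / 2) (n : ℕ) :
    inner ℂ (vacuum H q) (((field q f ^ 2) ^ n) (vacuum H q))
      = ((∫ x, x ^ n ∂(muMeasure (1 + q)) : ℝ) : ℂ) := by
  have ha : 1 < 1 + (q : ℝ) := by linarith
  have := isFiniteMeasure_muMeasure ha
  set M : ℝ := max 1 (a₁ (1 + q)) with hM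
  have hM0 : 0 < M := lt_max_of_lt_left one_pos
  have hbound : ∀ᵐ x ∂(muMeasure (1 + q)), |x| ≤ M := by
    have h : ∀ᵐ x ∂(muMeasure (1 + (q : ℝ))),
        x ∈ Set.Icc (min 0 (a₁ (1 + (q : ℝ)))) (max 1 (a₁ (1 + (q : ℝ)))) :=
      muMeasure_compl_Icc (1 + (q : ℝ))
    filter_upwards [h] with x hx
    rw [min_eq_left (a₁_pos ha).le] at hx
    rw [abs_of_nonneg hx.1]
    exact hx.2
  have hev : ∀ᶠ t in nhds (0 : ℝ), |t| * M < 1 :=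
    Filter.Tendsto.eventually_lt_const (by simp)
      (ContinuousAt.tendsto (f := fun t : ℝ => |t| * M) (x := 0) (by fun_prop))
  have hev' : ∀ᶠ t in nhds (0 : ℝ), t < 1 / a₁ (1 + (q : ℝ)) :=
    Iio_mem_nhds (one_div_pos.2 (a₁_pos ha))
  refine congrFun (eq_of_hasSum_pow_smul_eventually
    (c := fun n => inner ℂ (vacuum H q) (((field q f ^ 2) ^ n) (vacuum H q)))
    (d := fun n => ((∫ x, x ^ n ∂(muMeasure (1 + q)) : ℝ) : ℂ))
    (hasSum_vacuum_moments q hf) ?_) n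
  filter_upwards [hev, hev', Iio_mem_nhds zero_lt_one] with t h1 h2 h3
  have h := hasSum_moments_integral hbound h1
  rw [(integral_one_div_muMeasure ha h3 fun _ => h2.ne).2] at h
  have h' := h.mapL Complex.ofRealCLM
  refine h'.congr_fun fun n => ?_
  simp

end QFock

theorem theorem3p2 {H : Type*} [NormedAddCommGroup H] [InnerProductSpace ℂ H] [CompleteSpace H]
    (q : Set.Icc (-1 : ℝ) 1) (a : ℝ) (haq : a = 1 + (q : ℝ)) (ha : a ∈ Set.Ioc (1 : ℝ) 2)
    (f : H) (hf : ‖f‖ = 1 / 2) :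
    (∀ t ∈ Set.Ioo (-1 : ℝ) 1, (3 / 2 < a → t ≠ 1 / QFock.a₁ a) →
      Integrable (fun x : ℝ => 1 / (1 - t * x)) (QFock.muMeasure a) ∧
        ∫ x, 1 / (1 - t * x) ∂(QFock.muMeasure a) = QFock.S a t) ∧
    IsDistribution (QFock.field q f ^ 2) (QFock.vacuum H q) (QFock.muMeasure a) := by
  refine ⟨fun t ht hne => QFock.integral_one_div_muMeasure ha.1 ht.2 hne,
    (QFock.isSelfAdjoint_field q f).pow 2, QFock.isProbabilityMeasure_muMeasure ha.1,
    ⟨_, isCompact_Icc, QFock.muMeasure_compl_Icc a⟩, fun n => ?_⟩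
  subst haq
  exact QFock.integral_pow_muMeasure q (by linarith [ha.1]) hf n
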